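/- Work in the complex space $L^2=L^2(0,1)$, and let $T>0$. Let $a,b\in L^\infty(0,1)$ be real and non-negative, let $q\in L^\infty(0,1)$ be real, let $u_0\in L^2$ be such that its second distributional derivative $u_0''$ belongs to $L^2$ and $u_0(0)=u_0(1)=0$ (for the continuous representative), and let $u_1\in L^2$. Let $\mathcal L=-\frac{d^2}{dx^2}+q$ be the Sturm–Liouville operator in $L^2$ whose domain consists of the $f\in L^2$ with $f''\in L^2$ and $f(0)=f(1)=0$. For $s\ge 0$ the fractional power $\mathcal L^{s}$ is defined by $\mathcal L^{s}\phi=\lambda^{s}\phi$ for each eigenfunction $\phi$ of $\mathcal L$ with eigenvalue $\lambda$ (principal complex power), that is, $\mathcal L^s f=g$ means $\langle \phi,g\rangle=\lambda^s\langle\phi,f\rangle$ for all eigenpairs $(\lambda,\phi)$; and $W^1_{\mathcal L}=\{f\in L^2:\ \mathcal L^{1/2}f\in L^2\}$ with $\|f\|_{W^1_{\mathcal L}}=\|\mathcal L^{1/2}f\|_{L^2}$. (If $0$ is an eigenvalue, this is only a seminorm, and continuity into $W^1_{\mathcal L}$ includes continuity into $L^2$.) Consider the problem $$ \begin{cases}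 u_{tt}(t,x)-u_{xx}(t,x)+q(x)u(t,x)+a(x)u(t,x)+b(x)u_t(t,x)=0, & (t,x)\in[0,T]\times(0,1),\\ u(0,x)=u_0(x),\quad u_t(0,x)=u_1(x), & x\in(0,1),\\ u(t,0)=u(t,1)=0, & t\in[0,T], \end{cases} $$ where the equation means that for every $\psi$ in the domain of $\mathcal L$ and every $t\in[0,T]$ (one-sided at the end points) $$\frac{d}{dt}\langle \psi,u_t(t)\rangle+\langle\mathcal L\psi,u(t)\rangle+\langle\psi,a\,u(t)+b\,u_t(t)\rangle=0 .$$ (1) The problem has a unique solution $u\in C([0,T];W^1_{\mathcal L})\cap C^1([0,T];L^2)$. (2) For every $m\in\mathbb R$ there is a constant $C>0$, depending only on $T$ and $m$, such that whenever all eigenvalues of $\mathcal L$ are $\ge m$, the solution satisfies, for all $t\in[0,T]$, $$ \max\big\{\|u(t,\cdot)\|_{L^2},\ \|\mathcal L^{1/2}u(t,\cdot)\|_{L^2},\ \|u_t(t,\cdot)\|_{L^2}\big\}\le C\,(1+\|q\|_{L^\infty})(1+\|a\|_{L^\infty})(1+\|b\|_{L^\infty})\big[\|u_0\|_{L^2}+\|u_0''\|_{L^2}+\|u_1\|_{L^2}\big].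 $$ In particular, $C$ is independent of $q,a,b,u_0,u_1$ as long as the eigenvalues of $\mathcal L$ are all greater than $1$. -/

import Mathlib

open Set Filter Topology MeasureTheory
open scoped ENNReal ContDiff

namespace SturmLiouville

/-- Lebesgue measure on the interval `(0,1)`. -/
noncomputable abbrev intervalMeasure : Measure ℝ := volume.restrict (Ioo (0 : ℝ) 1)

/-- The complex Hilbert space `L²(0,1)`. -/
abbrev L2 : Type := Lp ℂ 2 intervalMeasure

/-- The space of real coefficients `L^∞(0,1)`, with the essential supremum norm. For `q : LInf`
and `f : L2`, Mathlib's `q • f : L2` is the pointwise product. -/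
abbrev LInf : Type := Lp ℝ ∞ intervalMeasure

/-- `h ∈ L²(0,1)` is the second distributional derivative on `(0,1)` of `f ∈ L²(0,1)`. -/
def HasWeakSecondDeriv (f h : L2) : Prop :=
  ∀ φ : ℝ → ℝ, ContDiff ℝ ∞ φ → HasCompactSupport φ → tsupport φ ⊆ Ioo (0 : ℝ) 1 →
    ∫ x in Ioo (0 : ℝ) 1, iteratedDeriv 2 φ x • f x = ∫ x in Ioo (0 : ℝ) 1, φ x • h x

/-- The Dirichlet condition `f(0) = f(1) = 0`: the class `f` has a representative that is
continuous on `[0,1]` and vanishes at both end points. -/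
def VanishesAtEndpoints (f : L2) : Prop :=
  ∃ F : ℝ → ℂ, ContinuousOn F (Icc 0 1) ∧ f =ᵐ[intervalMeasure] F ∧ F 0 = 0 ∧ F 1 = 0

/-- The graph of the Dirichlet Sturm-Liouville operator `𝓛 = -d²/dx² + q` in `L²(0,1)`:
`f` lies in the domain of `𝓛`, and `𝓛 f = g`. -/
def IsSturmLiouville (q : LInf) (f g : L2) : Prop :=
  VanishesAtEndpoints f ∧ ∃ h : L2, HasWeakSecondDeriv f h ∧ g = -h + q • f

/-- `φ` is an eigenfunction of `𝓛` for the eigenvalue `l`. The operator is self-adjoint, so that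
all its eigenvalues are real. -/
def IsEigenpair (q : LInf) (l : ℝ) (φ : L2) : Prop :=
  φ ≠ 0 ∧ IsSturmLiouville q φ ((l : ℂ) • φ)

/-- The graph of the fractional power `𝓛^s`: the operator acts on every eigenfunction of
eigenvalue `l` as multiplication by `l^s`. That is, `𝓛^s f = g` when each Fourier coefficient of
`g` is `l^s` times that of `f`. The power is the principal complex power, as finitely many
eigenvalues can be negative. -/
def IsFractionalPower (q : LInf) (s : ℝ) (f g : L2) : Prop :=
  ∀ (l : ℝ) (φ : L2), IsEigenpair q l φ →
    inner ℂ φ g = (l : ℂ) ^ (s : ℂ) * inner ℂ φ f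

/-- `u ∈ C([0,T]; W^s_𝓛(0,1))`, where `W^s_𝓛(0,1)`, for `s ≥ 0`, consists of the `f ∈ L²(0,1)` with
`𝓛^{s/2} f ∈ L²(0,1)` and has the norm `‖𝓛^{s/2} f‖`. -/
def IsContinuousIntoSobolev (T : ℝ) (q : LInf) (s : ℝ) (u : ℝ → L2) : Prop :=
  ContinuousOn u (Icc 0 T) ∧
    ∃ w : ℝ → L2, (∀ t ∈ Icc 0 T, IsFractionalPower q (s / 2) (u t) (w t)) ∧
      ContinuousOn w (Icc 0 T)

/-- The time derivative `u_t` on `[0,T]`, one-sided at the end points. -/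
noncomputable def timeDeriv (T : ℝ) (u : ℝ → L2) (t : ℝ) : L2 := derivWithin u (Icc 0 T) t

/-- `u_tt + 𝓛 u + a u + b u_t = 0` on `[0,T] × (0,1)`, tested in space against the
functions `ψ` in the domain of `𝓛`. -/
def SatisfiesWaveEquation (T : ℝ) (q a b : LInf) (u : ℝ → L2) : Prop :=
  ∀ ψ Lψ : L2, IsSturmLiouville q ψ Lψ → ∀ t ∈ Icc 0 T,
    HasDerivWithinAt (fun τ => inner ℂ ψ (timeDeriv T u τ))
      (-(inner ℂ Lψ (u t) + inner ℂ ψ (a • u t) + inner ℂ ψ (b • timeDeriv T u t)))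
      (Icc 0 T) t

/-- `u ∈ C([0,T]; W^1_𝓛(0,1)) ∩ C^1([0,T]; L²(0,1))` solves the initial/boundary problem
`u_tt + 𝓛 u + a u + b u_t = 0`, `u(0,·) = u₀`, `u_t(0,·) = u₁`, `u(t,0) = u(t,1) = 0`. -/
structure IsSolution (T : ℝ) (q a b : LInf) (u₀ u₁ : L2) (u : ℝ → L2) : Prop where
  continuous_sobolev : IsContinuousIntoSobolev T q 1 u
  contDiff : ContDiffOn ℝ 1 u (Icc 0 T)
  equation : SatisfiesWaveEquation T q a b u
  initial : u 0 = u₀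
  initial_deriv : timeDeriv T u 0 = u₁
  boundary : ∀ t ∈ Icc 0 T, VanishesAtEndpoints (u t)

end SturmLiouville

/-! Let `M` be so large that `𝓛 + M ≥ 1`. With `p = (𝓛 + M)^{1/2} u`, `r = u_t` and `ν = √(l + M)`,
the wave equation becomes, on each eigenfunction of eigenvalue `l`, the system `p' = ν r`, `r' = -ν
p + F`, where `F = M u - a u - b u_t`. Since `u = (𝓛 + M)^{-1/2} p`, the force `F` is a bounded
linear function of `(p, r)`, so the problem is a bounded perturbation of a unitary group.

The eigenbasis comes from compactness. The inverse of the Dirichlet Laplacian is `B B*`, where `B`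
is the compact operator `primitiveZero`. With `V = q + ‖q‖ ≥ 0`, the inverse of `𝓛 + ‖q‖` is `B (1 +
B* V B)⁻¹ B*`, which is compact, symmetric and injective, so `exists_hilbertBasis_isEigenpair`
follows from the spectral theorem.

Existence (`exists_isSolution`): the variables `e^{iνt}(p + i r)` and `e^{-iνt}(p - i r)` satisfy an
equation with globally Lipschitz right hand side, and Picard iteration solves it on all of `[0,T]`.

Estimate (`IsSolution.norm_le`): the energy `G = ‖p‖² + ‖r‖² + ⟨u, a u⟩` has `G' = 2M Re⟨r, u⟩ -
2⟨r, b r⟩ ≤ M G`, because `b ≥ 0` and `‖u‖ ≤ ‖p‖`. Hence `G(t) ≤ e^{MT} G(0)`, at a rate depending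
only on the lower bound of the spectrum, while `G(0)` is controlled by the data through `‖p(0)‖² =
⟨u₀, (𝓛 + M) u₀⟩`. Uniqueness is this estimate applied to the difference of two solutions. -/

namespace SturmLiouville

/-! ### The primitive operator on `L²(0,1)` -/

/-- The class in `L²(0,1)` of the indicator function of `(0,x)`. -/
noncomputable def initialIndicator (x : ℝ) : L2 :=
  indicatorConstLp 2 (measurableSet_Iio (a := x)) (measure_ne_top intervalMeasure _) (1 : ℂ)

/-- The primitive `x ↦ ∫_0^x f` of `f ∈ L²(0,1)`. -/
noncomputable def primitive (f : L2) (x : ℝ) : ℂ := ∫ y in Iio x, f y ∂intervalMeasure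

instance isProbabilityMeasure_intervalMeasure : IsProbabilityMeasure intervalMeasure :=
  ⟨by simp [intervalMeasure]⟩

/-- Point values of the primitive are pairings with a continuous curve in `L²`; continuity, bounds
and compactness all follow from this. -/
lemma inner_initialIndicator (x : ℝ) (f : L2) :
    inner ℂ (initialIndicator x) f = primitive f x :=
  L2.inner_indicatorConstLp_one _ _ f

/-- The two indicators differ only between `x` and `y`, a set of measure at most `|x - y|`. -/
lemma dist_initialIndicator_le (x y : ℝ) :
    dist (initialIndicator x) (initialIndicator y) ≤ √|x - y| := by
  rw [initialIndicator, initialIndicator, dist_indicatorConstLp_eq_norm,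
    norm_indicatorConstLp (by simp) (by simp)]
  rw [Real.sqrt_eq_rpow]
  simp only [norm_one, one_mul, ENNReal.toReal_ofNat]
  refine Real.rpow_le_rpow measureReal_nonneg ?_ (by norm_num)
  have h1 : intervalMeasure.real (symmDiff (Iio x) (Iio y)) ≤ volume.real (uIcc x y) := by
    refine ENNReal.toReal_mono (by simp [uIcc]) ?_
    refine (Measure.restrict_apply_le _ _).trans (measure_mono ?_)
    intro z hz
    rcases hz with ⟨h1, h2⟩ | ⟨h1, h2⟩
    · exact ⟨by simp at h1 h2 ⊢; tauto, by simp at h1 h2 ⊢; left; linarith⟩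
    · exact ⟨by simp at h1 h2 ⊢; tauto, by simp at h1 h2 ⊢; right; linarith⟩
  refine h1.trans (le_of_eq ?_)
  rw [Measure.real, Real.volume_interval, ENNReal.toReal_ofReal (abs_nonneg _), abs_sub_comm]

lemma continuous_initialIndicator : Continuous initialIndicator := by
  rw [continuous_iff_continuousAt]
  intro x
  rw [ContinuousAt, tendsto_iff_dist_tendsto_zero]
  refine squeeze_zero (fun _ => dist_nonneg) (fun y => dist_initialIndicator_le y x) ?_
  have : Continuous fun y : ℝ => √|y - x| := by fun_prop
  simpa using this.tendsto x

lemma norm_initialIndicator_le (x : ℝ) : ‖initialIndicator x‖ ≤ 1 := by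
  rw [initialIndicator, norm_indicatorConstLp (by simp) (by simp)]
  simp only [norm_one, one_mul]
  exact Real.rpow_le_one measureReal_nonneg measureReal_le_one (by positivity)

lemma continuous_primitive (f : L2) : Continuous (primitive f) := by
  rw [show primitive f = fun x => inner ℂ (initialIndicator x) f from
    funext fun x => (inner_initialIndicator x f).symm]
  exact continuous_initialIndicator.inner continuous_const

lemma norm_primitive_le (f : L2) (x : ℝ) : ‖primitive f x‖ ≤ ‖f‖ := by
  rw [← inner_initialIndicator]
  refine (norm_inner_le_norm _ _).trans ?_
  exact mul_le_of_le_one_left (norm_nonneg _) (norm_initialIndicator_le x)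

lemma memLp_primitive (f : L2) : MemLp (primitive f) 2 intervalMeasure :=
  MemLp.of_bound (continuous_primitive f).aestronglyMeasurable ‖f‖
    (ae_of_all _ (norm_primitive_le f))

lemma norm_le_of_ae_bound {f : L2} {C : ℝ} (hC : 0 ≤ C)
    (h : ∀ᵐ x ∂intervalMeasure, ‖f x‖ ≤ C) : ‖f‖ ≤ C := by
  refine (Lp.norm_le_of_ae_bound hC h).trans (le_of_eq ?_)
  have : measureUnivNNReal intervalMeasure = 1 := by
    simp [measureUnivNNReal, measure_univ]
  simp [this]

/-- The operator `f ↦ (x ↦ ∫_0^x f)` on `L²(0,1)`. -/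
noncomputable def primitiveL : L2 →L[ℂ] L2 :=
  LinearMap.mkContinuous
    { toFun := fun f => (memLp_primitive f).toLp
      map_add' := fun f g => by
        rw [← MemLp.toLp_add]
        congr 1
        ext x
        simp [← inner_initialIndicator, inner_add_right]
      map_smul' := fun c f => by
        rw [RingHom.id_apply, ← MemLp.toLp_const_smul]
        congr 1
        ext x
        simp [← inner_initialIndicator, inner_smul_right] }
    1 (fun f => by
      rw [one_mul]
      refine norm_le_of_ae_bound (norm_nonneg _) ?_
      filter_upwards [(memLp_primitive f).coeFn_toLp] with x hx
      simp only [LinearMap.coe_mk, AddHom.coe_mk, hx]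
      exact norm_primitive_le f x)

lemma coeFn_primitiveL (f : L2) : primitiveL f =ᵐ[intervalMeasure] primitive f :=
  (memLp_primitive f).coeFn_toLp

/-- Norm limit of finite rank operators: the indicators of `(0,x)` form a compact curve, so they lie
within `ε/2` of a finite set `t`. Replacing `f` by its projection onto the span of `t` changes every
point value of the primitive by at most `ε/2 ‖f‖`. -/
lemma isCompactOperator_primitiveL : IsCompactOperator primitiveL := by
  have hcl := isClosed_setOfPred_isCompactOperator (σ₁₂ := RingHom.id ℂ) (M₁ := L2) (M₂ := L2)
  refine hcl.closure_subset (Metric.mem_closure_iff.2 fun ε hε => ?_)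
  obtain ⟨t, -, htf, ht⟩ := ((isCompact_Icc (a := (0 : ℝ)) (b := 1)).image
    continuous_initialIndicator).finite_cover_balls (half_pos hε)
  let F : Submodule ℂ L2 := Submodule.span ℂ t
  have : FiniteDimensional ℂ F := FiniteDimensional.span_of_finite ℂ htf
  refine ⟨primitiveL ∘L F.starProjection, ?_, ?_⟩
  · have h1 : IsCompactOperator F.orthogonalProjectionOnto :=
      isCompactOperator_of_locallyCompactSpace_dom _
    exact (h1.clm_comp F.subtypeL).clm_comp primitiveL
  · rw [dist_eq_norm]
    refine (ContinuousLinearMap.opNorm_le_bound _ (half_pos hε).le fun f => ?_).trans_lt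
      (half_lt_self hε)
    refine norm_le_of_ae_bound (by positivity) ?_
    have h1 : (primitiveL - primitiveL ∘L F.starProjection) f =
        primitiveL (f - F.starProjection f) := by simp
    rw [h1]
    filter_upwards [coeFn_primitiveL (f - F.starProjection f),
      ae_restrict_mem measurableSet_Ioo] with x hx hx01
    rw [hx, ← inner_initialIndicator]
    obtain ⟨e, het, hxe⟩ := mem_iUnion₂.1 (ht ⟨x, Ioo_subset_Icc_self hx01, rfl⟩)
    have h2 : inner ℂ e (f - F.starProjection f) = 0 := by
      have := Submodule.sub_starProjection_mem_orthogonal (K := F) f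
      exact this e (Submodule.subset_span het)
    have h3 : inner ℂ (initialIndicator x) (f - F.starProjection f) =
        inner ℂ (initialIndicator x - e) (f - F.starProjection f) := by
      rw [inner_sub_left, h2, sub_zero]
    rw [h3]
    refine (norm_inner_le_norm _ _).trans ?_
    refine mul_le_mul ?_ ?_ (norm_nonneg _) (half_pos hε).le
    · rw [← dist_eq_norm]; exact (Metric.mem_ball.1 hxe).le
    · rw [← Submodule.starProjection_orthogonal_val]
      exact Submodule.norm_starProjection_apply_le _ _

/-! ### The Green operator of the Dirichlet Laplacian -/

lemma integrable_coeFn (f : L2) : Integrable f intervalMeasure :=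
  (Lp.memLp f).integrable (by norm_num)

/-- Integration by parts, obtained from Fubini: the two terms integrate `conj f(y) g(x)` over the
triangles `y < x` and `y > x`, which together fill the square up to a null set. -/
lemma inner_primitiveL_add (f g : L2) :
    inner ℂ (primitiveL f) g + inner ℂ f (primitiveL g) =
      starRingEnd ℂ (∫ x, f x ∂intervalMeasure) * ∫ x, g x ∂intervalMeasure := by
  set μ := intervalMeasure
  have hf : Integrable (fun x => starRingEnd ℂ (f x)) μ :=
    (RCLike.conjCLE (K := ℂ)).toContinuousLinearMap.integrable_comp (integrable_coeFn f)
  have hg : Integrable g μ := integrable_coeFn g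
  have h1 : inner ℂ (primitiveL f) g = ∫ x, (∫ y in Iio x, starRingEnd ℂ (f y) ∂μ) * g x ∂μ := by
    rw [L2.inner_def]
    refine integral_congr_ae ?_
    filter_upwards [coeFn_primitiveL f] with x hx
    rw [hx, RCLike.inner_apply, mul_comm, primitive, ← integral_conj]
  have h2 : inner ℂ f (primitiveL g) = ∫ x, (∫ y in Ioi x, starRingEnd ℂ (f y) ∂μ) * g x ∂μ := by
    have hint : Integrable (Function.uncurry fun x y =>
        (Iio x).indicator (fun y => starRingEnd ℂ (f x) * g y) y) (μ.prod μ) := by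
      have hm : MeasurableSet {z : ℝ × ℝ | z.2 < z.1} :=
        measurableSet_lt measurable_snd measurable_fst
      refine ((hf.mul_prod hg).indicator hm).congr (ae_of_all _ fun z => ?_)
      simp [Function.uncurry, indicator]
    calc inner ℂ f (primitiveL g)
        = ∫ x, ∫ y, (Iio x).indicator (fun y => starRingEnd ℂ (f x) * g y) y ∂μ ∂μ := by
          rw [L2.inner_def]
          refine integral_congr_ae ?_
          filter_upwards [coeFn_primitiveL g] with x hx
          rw [hx, RCLike.inner_apply, mul_comm, primitive, integral_indicator measurableSet_Iio,
            integral_const_mul]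
      _ = ∫ y, ∫ x, (Iio x).indicator (fun y => starRingEnd ℂ (f x) * g y) y ∂μ ∂μ :=
          integral_integral_swap hint
      _ = ∫ x, (∫ y in Ioi x, starRingEnd ℂ (f y) ∂μ) * g x ∂μ := by
          congr 1
          ext y
          rw [← integral_mul_const, ← integral_indicator measurableSet_Ioi]
          congr 1
  have hb1 (s : ℝ → Set ℝ) (x : ℝ) :
      ‖∫ y in s x, starRingEnd ℂ (f y) ∂μ‖ ≤ ∫ y, ‖starRingEnd ℂ (f y)‖ ∂μ :=
    (norm_integral_le_integral_norm _).trans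
      (setIntegral_le_integral hf.norm (ae_of_all _ fun _ => norm_nonneg _))
  have hsum (x : ℝ) : (∫ y in Iio x, starRingEnd ℂ (f y) ∂μ) + ∫ y in Ioi x, starRingEnd ℂ (f y) ∂μ
      = starRingEnd ℂ (∫ x, f x ∂μ) := by
    rw [← setIntegral_congr_set Ioi_ae_eq_Ici.symm]
    have := integral_add_compl (measurableSet_Iio (a := x)) hf
    rw [compl_Iio] at this
    rw [this, integral_conj]
  have hi1 : Integrable (fun x => (∫ y in Iio x, starRingEnd ℂ (f y) ∂μ) * g x) μ := by
    refine hg.bdd_mul (c := ∫ y, ‖starRingEnd ℂ (f y)‖ ∂μ) ?_ (ae_of_all _ (hb1 Iio))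
    have : (fun x => ∫ y in Iio x, starRingEnd ℂ (f y) ∂μ) =
        fun x => starRingEnd ℂ (primitive f x) := by
      ext x; rw [primitive, ← integral_conj]
    rw [this]
    exact (RCLike.continuous_conj.comp (continuous_primitive f)).aestronglyMeasurable
  have hi2 : Integrable (fun x => (∫ y in Ioi x, starRingEnd ℂ (f y) ∂μ) * g x) μ := by
    have : (fun x => (∫ y in Ioi x, starRingEnd ℂ (f y) ∂μ) * g x) = fun x =>
        starRingEnd ℂ (∫ x, f x ∂μ) * g x - (∫ y in Iio x, starRingEnd ℂ (f y) ∂μ) * g x := by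
      ext x; rw [← hsum x]; ring
    rw [this]
    exact (hg.const_mul _).sub hi1
  rw [h1, h2, ← integral_add hi1 hi2, ← integral_const_mul]
  congr 1
  ext x
  rw [← hsum x]
  ring

/-- The constant function `1` in `L²(0,1)`. -/
noncomputable def oneL2 : L2 := (memLp_const (1 : ℂ)).toLp

lemma coeFn_oneL2 : oneL2 =ᵐ[intervalMeasure] fun _ => (1 : ℂ) := MemLp.coeFn_toLp _

lemma inner_oneL2 (f : L2) : inner ℂ oneL2 f = ∫ x, f x ∂intervalMeasure := by
  rw [L2.inner_def]
  refine integral_congr_ae ?_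
  filter_upwards [coeFn_oneL2] with x hx
  simp [hx]

/-- The orthogonal projection onto the functions of mean zero. -/
noncomputable def subMean : L2 →L[ℂ] L2 :=
  ContinuousLinearMap.id ℂ L2 - (innerSL ℂ oneL2).smulRight oneL2

lemma subMean_apply (f : L2) : subMean f = f - inner ℂ oneL2 f • oneL2 := by
  simp [subMean]

lemma inner_subMean (f g : L2) : inner ℂ (subMean f) g = inner ℂ f (subMean g) := by
  simp only [subMean_apply, inner_sub_left, inner_sub_right, inner_smul_left, inner_smul_right,
    inner_conj_symm]
  ring

/-- The operator `f ↦ (x ↦ ∫_0^x (f - ∫ f))`, whose range is the Sobolev space `H¹₀(0,1)`. -/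
noncomputable def primitiveZero : L2 →L[ℂ] L2 := primitiveL ∘L subMean

/-- The solution operator of `-f'' = h`, `f(0) = f(1) = 0`. -/
noncomputable def green : L2 →L[ℂ] L2 :=
  primitiveZero ∘L ContinuousLinearMap.adjoint primitiveZero

lemma isCompactOperator_primitiveZero : IsCompactOperator primitiveZero :=
  isCompactOperator_primitiveL.comp_clm subMean

lemma inner_oneL2_self : inner ℂ oneL2 oneL2 = 1 := by
  rw [inner_oneL2, integral_congr_ae coeFn_oneL2]
  simp

lemma vanishesAtEndpoints_primitiveZero (k : L2) : VanishesAtEndpoints (primitiveZero k) := by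
  refine ⟨primitive (subMean k), (continuous_primitive _).continuousOn, coeFn_primitiveL _, ?_, ?_⟩
  · rw [primitive, Measure.restrict_restrict measurableSet_Iio]
    have : Iio (0 : ℝ) ∩ Ioo 0 1 = ∅ := by ext; simp; intros; linarith
    simp [this]
  · have : primitive (subMean k) 1 = ∫ x, subMean k x ∂intervalMeasure := by
      rw [primitive, Measure.restrict_restrict measurableSet_Iio]
      congr 2
      ext; simp
    rw [this, ← inner_oneL2, subMean_apply, inner_sub_right, inner_smul_right, inner_oneL2_self]
    simp

lemma inner_green_left (f g : L2) :
    inner ℂ (green f) g = inner ℂ f (green g) := by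
  simp only [green, ContinuousLinearMap.comp_apply]
  rw [← ContinuousLinearMap.adjoint_inner_right, ContinuousLinearMap.adjoint_inner_left]

lemma adjoint_primitiveL (g : L2) :
    ContinuousLinearMap.adjoint primitiveL g = inner ℂ oneL2 g • oneL2 - primitiveL g := by
  refine ext_inner_left ℂ fun f => ?_
  rw [ContinuousLinearMap.adjoint_inner_right, inner_sub_right, inner_smul_right, eq_sub_iff_add_eq,
    inner_primitiveL_add, ← inner_oneL2, ← inner_oneL2, inner_conj_symm, mul_comm]

lemma adjoint_primitiveZero (g : L2) : ContinuousLinearMap.adjoint primitiveZero g =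
    subMean (inner ℂ oneL2 g • oneL2 - primitiveL g) := by
  refine ext_inner_left ℂ fun f => ?_
  rw [ContinuousLinearMap.adjoint_inner_right, primitiveZero, ContinuousLinearMap.comp_apply,
    ← adjoint_primitiveL, ← inner_subMean, ContinuousLinearMap.adjoint_inner_right]

/-! ### Test functions -/

/-- The smooth functions with compact support in `(0,1)`. -/
def IsTest (φ : ℝ → ℝ) : Prop :=
  ContDiff ℝ ∞ φ ∧ HasCompactSupport φ ∧ tsupport φ ⊆ Ioo (0 : ℝ) 1

protected lemma IsTest.deriv {φ : ℝ → ℝ} (h : IsTest φ) : IsTest (deriv φ) :=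
  ⟨h.1.iterate_deriv 1, h.2.1.deriv, tsupport_deriv_subset.trans h.2.2⟩

lemma IsTest.memLp {φ : ℝ → ℝ} (h : IsTest φ) :
    MemLp (fun x => (φ x : ℂ)) 2 intervalMeasure := by
  obtain ⟨C, hC⟩ := h.2.1.exists_bound_of_continuous h.1.continuous
  exact MemLp.of_bound (Complex.continuous_ofReal.comp h.1.continuous).aestronglyMeasurable C
    (ae_of_all _ fun x => by simpa using hC x)

/-- The class of a test function in `L²(0,1)`. -/
noncomputable def IsTest.toL2 {φ : ℝ → ℝ} (h : IsTest φ) : L2 := h.memLp.toLp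

lemma IsTest.coeFn_toL2 {φ : ℝ → ℝ} (h : IsTest φ) :
    h.toL2 =ᵐ[intervalMeasure] fun x => (φ x : ℂ) := h.memLp.coeFn_toLp

lemma IsTest.inner_toL2 {φ : ℝ → ℝ} (h : IsTest φ) (f : L2) :
    inner ℂ h.toL2 f = ∫ x in Ioo (0 : ℝ) 1, φ x • f x := by
  rw [L2.inner_def]
  refine integral_congr_ae ?_
  filter_upwards [h.coeFn_toL2] with x hx
  rw [hx, RCLike.inner_apply]
  simp [mul_comm]

lemma IsTest.eq_zero {φ : ℝ → ℝ} (h : IsTest φ) {x : ℝ} (hx : x ∉ Ioo (0 : ℝ) 1) : φ x = 0 :=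
  image_eq_zero_of_notMem_tsupport fun h' => hx (h.2.2 h')

lemma IsTest.primitiveL_deriv {φ : ℝ → ℝ} (h : IsTest φ) :
    primitiveL h.deriv.toL2 = h.toL2 := by
  refine Lp.ext ?_
  filter_upwards [coeFn_primitiveL h.deriv.toL2, h.coeFn_toL2, ae_restrict_mem measurableSet_Ioo]
    with x h1 h2 hx
  rw [h1, h2, primitive, integral_congr_ae (ae_restrict_of_ae h.deriv.coeFn_toL2), integral_complex_ofReal]
  congr 1
  rw [Measure.restrict_restrict measurableSet_Iio]
  have : Iio x ∩ Ioo 0 1 = Ioo 0 x := by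
    ext y; simp only [mem_inter_iff, mem_Iio, mem_Ioo] at hx ⊢
    constructor
    · rintro ⟨a, b, c⟩; exact ⟨b, a⟩
    · rintro ⟨a, b⟩; exact ⟨b, a, b.trans hx.2⟩
  rw [this, ← integral_Ioc_eq_integral_Ioo, ← intervalIntegral.integral_of_le hx.1.le,
    intervalIntegral.integral_deriv_eq_sub (fun y _ => (h.1.differentiable (by simp)).differentiableAt)
      (h.deriv.1.continuous.intervalIntegrable _ _), h.eq_zero (x := 0) (by simp), sub_zero]

lemma IsTest.inner_oneL2_deriv {φ : ℝ → ℝ} (h : IsTest φ) :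
    inner ℂ oneL2 h.deriv.toL2 = 0 := by
  rw [inner_oneL2, integral_congr_ae h.deriv.coeFn_toL2, integral_complex_ofReal,
    ← integral_Ioc_eq_integral_Ioo, ← intervalIntegral.integral_of_le zero_le_one,
    intervalIntegral.integral_deriv_eq_sub (fun y _ => (h.1.differentiable (by simp)).differentiableAt)
      (h.deriv.1.continuous.intervalIntegrable _ _), h.eq_zero (x := 0) (by simp),
    h.eq_zero (x := 1) (by simp)]
  simp

/-- Both `φ'` and `φ''` have mean zero, so the mean corrections disappear and two integrations
remain. The symmetry of `green` then transfers this to weak derivatives. -/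
lemma IsTest.green_deriv_deriv {φ : ℝ → ℝ} (h : IsTest φ) :
    green h.deriv.deriv.toL2 = -h.toL2 := by
  rw [green, ContinuousLinearMap.comp_apply, adjoint_primitiveZero, h.deriv.inner_oneL2_deriv,
    h.deriv.primitiveL_deriv, zero_smul, zero_sub, primitiveZero, ContinuousLinearMap.comp_apply]
  have h1 : subMean (-h.deriv.toL2) = -h.deriv.toL2 := by
    rw [subMean_apply, inner_neg_right, h.inner_oneL2_deriv]; simp
  rw [h1, h1, map_neg, h.primitiveL_deriv]

lemma hasWeakSecondDeriv_iff {f h : L2} : HasWeakSecondDeriv f h ↔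
    ∀ (φ : ℝ → ℝ) (hφ : IsTest φ), inner ℂ hφ.deriv.deriv.toL2 f = inner ℂ hφ.toL2 h := by
  refine ⟨fun H φ hφ => ?_, fun H φ h1 h2 h3 => ?_⟩
  · rw [IsTest.inner_toL2, IsTest.inner_toL2, ← H φ hφ.1 hφ.2.1 hφ.2.2]
    simp [iteratedDeriv_succ]
  · have hφ : IsTest φ := ⟨h1, h2, h3⟩
    have := H φ hφ
    rw [IsTest.inner_toL2, IsTest.inner_toL2] at this
    rw [← this]
    simp [iteratedDeriv_succ]

lemma hasWeakSecondDeriv_green (h : L2) : HasWeakSecondDeriv (green h) (-h) := by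
  refine hasWeakSecondDeriv_iff.2 fun φ hφ => ?_
  rw [← inner_green_left, hφ.green_deriv_deriv, inner_neg_left, inner_neg_right]

/-- The primitive from `0` vanishes to the left of the support of `ψ`, and to the right of it
because the total integral is zero. -/
lemma IsTest.exists_primitive {ψ : ℝ → ℝ} (h : IsTest ψ) (h0 : ∫ x in (0 : ℝ)..1, ψ x = 0) :
    ∃ φ, IsTest φ ∧ deriv φ = ψ := by
  obtain ⟨c, d, hc, hd, hcd⟩ : ∃ c d : ℝ, 0 < c ∧ d < 1 ∧ tsupport ψ ⊆ Icc c d := by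
    rcases (tsupport ψ).eq_empty_or_nonempty with he | hne
    -- For empty support any empty interval serves, here `Icc 1 0`.
    · exact ⟨1, 0, by norm_num, by norm_num, by simp [he]⟩
    · have hK : IsCompact (tsupport ψ) := h.2.1
      obtain ⟨c, hc⟩ := hK.exists_isLeast hne
      obtain ⟨d, hd⟩ := hK.exists_isGreatest hne
      exact ⟨c, d, (h.2.2 hc.1).1, (h.2.2 hd.1).2, fun x hx => ⟨hc.2 hx, hd.2 hx⟩⟩
  have hz (x : ℝ) (hx : x ∉ Icc c d) : ψ x = 0 :=
    image_eq_zero_of_notMem_tsupport fun h' => hx (hcd h')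
  have hcont := h.1.continuous
  have hder : ∀ x, HasDerivAt (fun x => ∫ y in (0 : ℝ)..x, ψ y) (ψ x) x := fun x =>
    intervalIntegral.integral_hasDerivAt_right (hcont.intervalIntegrable _ _)
      (hcont.stronglyMeasurableAtFilter _ _) hcont.continuousAt
  have hd' : deriv (fun x => ∫ y in (0 : ℝ)..x, ψ y) = ψ := funext fun x => (hder x).deriv
  have hsupp : tsupport (fun x => ∫ y in (0 : ℝ)..x, ψ y) ⊆ Icc c d := by
    refine closure_minimal (fun x hx => ?_) isClosed_Icc
    by_contra hx'
    refine hx ?_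
    simp only
    rcases lt_or_ge x c with h1 | h1
    · rw [intervalIntegral.integral_congr (g := fun _ => 0)]
      · simp
      · intro y hy
        refine hz y fun hy' => ?_
        have := (mem_uIcc.1 hy)
        rcases this with h | h <;> linarith [hy'.1]
    · have h2 : d < x := not_le.1 fun h2 => hx' ⟨h1, h2⟩
      rw [← intervalIntegral.integral_add_adjacent_intervals (b := 1)
        (hcont.intervalIntegrable _ _) (hcont.intervalIntegrable _ _), h0, zero_add,
        intervalIntegral.integral_congr (g := fun _ => 0)]
      · simp
      · intro y hy
        refine hz y fun hy' => ?_
        have := (mem_uIcc.1 hy)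
        rcases this with h | h <;> linarith [hy'.2]
  refine ⟨_, ⟨?_, ?_, ?_⟩, hd'⟩
  · rw [contDiff_infty_iff_deriv, hd']
    exact ⟨fun x => (hder x).differentiableAt, h.1⟩
  · exact isCompact_Icc.of_isClosed_subset (isClosed_tsupport _) hsupp
  · exact hsupp.trans fun x hx => ⟨hc.trans_le hx.1, hx.2.trans_lt hd⟩

/-- Integration by parts turns the vanishing first moment of `ψ` into mean zero for its primitive,
which can then be integrated once more. -/
lemma IsTest.exists_deriv_deriv {ψ : ℝ → ℝ} (h : IsTest ψ) (h0 : ∫ x in (0 : ℝ)..1, ψ x = 0)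
    (h1 : ∫ x in (0 : ℝ)..1, x * ψ x = 0) : ∃ φ, IsTest φ ∧ deriv (deriv φ) = ψ := by
  obtain ⟨φ, hφ, rfl⟩ := h.exists_primitive h0
  have hd (x : ℝ) : HasDerivAt φ (deriv φ x) x :=
    ((hφ.1.differentiable (by simp)).differentiableAt).hasDerivAt
  have := intervalIntegral.integral_mul_deriv_eq_deriv_mul (a := 0) (b := 1)
    (u := fun x => x) (u' := fun _ => 1) (v := φ) (v' := deriv φ)
    (fun x _ => hasDerivAt_id x) (fun x _ => hd x) (by simp)
    (h.1.continuous.intervalIntegrable _ _)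
  rw [h1, hφ.eq_zero (x := 1) (by simp)] at this
  obtain ⟨χ, hχ, rfl⟩ := hφ.exists_primitive (by simpa using this.symm)
  exact ⟨χ, hχ, rfl⟩

/-- The real vector space of test functions. -/
def testSpace : Submodule ℝ (ℝ → ℝ) where
  carrier := {φ | IsTest φ}
  add_mem' := fun {a b} ha hb =>
    ⟨ha.1.add hb.1, ha.2.1.add hb.2.1, (tsupport_add a b).trans (union_subset ha.2.2 hb.2.2)⟩
  zero_mem' := ⟨contDiff_const, HasCompactSupport.zero, by simp [tsupport]⟩
  smul_mem' := fun c φ h =>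
    ⟨h.1.const_smul c, h.2.1.smul_left (f := fun _ => c),
      (tsupport_smul_subset_right (fun _ => c) φ).trans h.2.2⟩

/-- The pairing of a real integrable function with the test functions. -/
noncomputable def testPairing (r : ℝ → ℝ) (hr : Integrable r intervalMeasure) :
    testSpace →ₗ[ℝ] ℝ :=
  have hint (φ : testSpace) : Integrable (fun x => φ.1 x * r x) intervalMeasure := by
    obtain ⟨C, hC⟩ := φ.2.2.1.exists_bound_of_continuous φ.2.1.continuous
    exact hr.bdd_mul φ.2.1.continuous.aestronglyMeasurable (ae_of_all _ hC)
  { toFun := fun φ => ∫ x, φ.1 x * r x ∂intervalMeasure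
    map_add' := fun a b => by
      rw [← integral_add (hint a) (hint b)]
      simp [add_mul]
    map_smul' := fun c a => by
      simp [mul_assoc, integral_const_mul] }

lemma testPairing_apply (r : ℝ → ℝ) (hr : Integrable r intervalMeasure) (φ : testSpace) :
    testPairing r hr φ = ∫ x, φ.1 x * r x ∂intervalMeasure := rfl

lemma integrable_affine (α β : ℝ) : Integrable (fun x : ℝ => α + β * x) intervalMeasure :=
  ((by fun_prop : Continuous fun x : ℝ => α + β * x).integrableOn_Icc (a := 0) (b := 1)).mono_set
    Ioo_subset_Icc_self

/-- A real function on `(0,1)` whose second distributional derivative vanishes is affine. -/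
lemma exists_affine_of_testPairing_eq_zero (r : ℝ → ℝ) (hr : Integrable r intervalMeasure)
    (h : ∀ φ, IsTest φ → ∫ x, deriv (deriv φ) x * r x ∂intervalMeasure = 0) :
    ∃ α β : ℝ, r =ᵐ[intervalMeasure] fun x => α + β * x := by
  have h0 : Integrable (fun _ : ℝ => (1 : ℝ)) intervalMeasure := by simp
  have h1 : Integrable (fun x : ℝ => x) intervalMeasure := by simpa using integrable_affine 0 1
  let ℓ : Fin 2 → testSpace →ₗ[ℝ] ℝ := ![testPairing _ h0, testPairing _ h1]
  -- A test function with vanishing mean and first moment is a second derivative of a test function,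
  -- so `r` annihilates it.
  have hker : ⨅ i, (ℓ i).ker ≤ (testPairing r hr).ker := by
    intro ψ hψ
    simp only [Submodule.mem_iInf, LinearMap.mem_ker, Fin.forall_fin_two] at hψ
    obtain ⟨e0, e1⟩ := hψ
    simp only [ℓ, Matrix.cons_val_zero, Matrix.cons_val_one, testPairing_apply] at e0 e1
    rw [← integral_Ioc_eq_integral_Ioo, ← intervalIntegral.integral_of_le zero_le_one] at e0 e1
    obtain ⟨φ, hφ, hφψ⟩ := IsTest.exists_deriv_deriv (ψ := ψ.1) ψ.2 (by simpa using e0)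
      (by simpa [mul_comm] using e1)
    rw [LinearMap.mem_ker, testPairing_apply, ← hφψ]
    exact h φ hφ
  -- A functional vanishing on the common kernel of finitely many functionals is a combination of
  -- them; its coefficients are those of the affine function.
  have hspan := mem_span_of_iInf_ker_le_ker hker
  obtain ⟨c, hc⟩ := (Submodule.mem_span_range_iff_exists_fun ℝ).1 hspan
  refine ⟨c 0, c 1, ?_⟩
  have hint : Integrable (fun x => r x - (c 0 + c 1 * x)) intervalMeasure :=
    hr.sub (integrable_affine _ _)
  have key := isOpen_Ioo.ae_eq_zero_of_integral_contDiff_smul_eq_zero (U := Ioo (0 : ℝ) 1)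
    (μ := volume) (f := fun x => r x - (c 0 + c 1 * x))
    (IntegrableOn.locallyIntegrableOn hint) (fun g g1 g2 g3 => ?_)
  · have := (ae_restrict_iff' measurableSet_Ioo).2 key
    filter_upwards [this] with x hx
    linarith
  · have hg : IsTest g := ⟨g1, g2, g3⟩
    have e := LinearMap.congr_fun hc ⟨g, hg⟩
    rw [← setIntegral_eq_integral_of_forall_compl_eq_zero (s := Ioo (0 : ℝ) 1)
      (fun x hx => by rw [hg.eq_zero hx, zero_smul])]
    have hb : ∀ s : ℝ → ℝ, Integrable s intervalMeasure →
        Integrable (fun x => g x * s x) intervalMeasure := fun s hs => by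
      obtain ⟨C, hC⟩ := g2.exists_bound_of_continuous g1.continuous
      exact hs.bdd_mul g1.continuous.aestronglyMeasurable (ae_of_all _ hC)
    simp only [Fin.sum_univ_two, ℓ, Matrix.cons_val_zero, Matrix.cons_val_one, LinearMap.add_apply,
      LinearMap.smul_apply, testPairing_apply, smul_eq_mul] at e
    rw [← integral_const_mul, ← integral_const_mul, ← integral_add ((hb _ h0).const_mul _)
      ((hb _ h1).const_mul _)] at e
    have e2 := integral_sub (hb _ hr) (((hb _ h0).const_mul (c 0)).add ((hb _ h1).const_mul (c 1)))
    change _ = _ - ∫ a, c 0 * (g a * 1) + c 1 * (g a * a) ∂intervalMeasure at e2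
    rw [e, sub_self] at e2
    refine Eq.trans (integral_congr_ae (ae_of_all _ fun x => ?_)) e2
    simp only [smul_eq_mul, Pi.add_apply]
    ring

lemma eq_zero_of_hasWeakSecondDeriv_zero {k : L2} (h : HasWeakSecondDeriv k 0)
    (hk : VanishesAtEndpoints k) : k = 0 := by
  have hint (φ : ℝ → ℝ) (hφ : IsTest φ) :
      ∫ x, ((deriv (deriv φ) x : ℝ) : ℂ) * k x ∂intervalMeasure = 0 := by
    have := hasWeakSecondDeriv_iff.1 h φ hφ
    rw [inner_zero_right, IsTest.inner_toL2] at this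
    simpa using this
  have hI (φ : ℝ → ℝ) (hφ : IsTest φ) :
      Integrable (fun x => ((deriv (deriv φ) x : ℝ) : ℂ) * k x) intervalMeasure := by
    have hd := hφ.deriv.deriv
    obtain ⟨C, hC⟩ := hd.2.1.exists_bound_of_continuous hd.1.continuous
    exact (integrable_coeFn k).bdd_mul
      (Complex.continuous_ofReal.comp hd.1.continuous).aestronglyMeasurable
      (ae_of_all _ fun x => by simpa using hC x)
  obtain ⟨α, β, hr⟩ := exists_affine_of_testPairing_eq_zero (fun x => (k x).re)
    (integrable_coeFn k).re fun φ hφ => by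
      have := congrArg Complex.re (hint φ hφ)
      have e := integral_re (hI φ hφ)
      simp only [RCLike.re_eq_complex_re] at e
      rw [← e] at this
      simpa using this
  obtain ⟨γ, δ, hi⟩ := exists_affine_of_testPairing_eq_zero (fun x => (k x).im)
    (integrable_coeFn k).im fun φ hφ => by
      have := congrArg Complex.im (hint φ hφ)
      have e := integral_im (hI φ hφ)
      simp only [RCLike.im_eq_complex_im] at e
      rw [← e] at this
      simpa using this
  obtain ⟨F, hF, hFk, hF0, hF1⟩ := hk
  -- Almost everywhere equality of continuous functions extends to all of `[0,1]`, so the affine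
  -- function vanishes at both end points.
  have hFr : EqOn (fun x => (F x).re) (fun x => α + β * x) (Icc 0 1) := by
    refine Measure.eqOn_Icc_of_ae_eq volume zero_ne_one ?_
      (Complex.continuous_re.comp_continuousOn hF) (by fun_prop)
    rw [← restrict_Ioo_eq_restrict_Icc]
    filter_upwards [hFk, hr] with x h1 h2
    rw [← h1, h2]
  have hFi : EqOn (fun x => (F x).im) (fun x => γ + δ * x) (Icc 0 1) := by
    refine Measure.eqOn_Icc_of_ae_eq volume zero_ne_one ?_
      (Complex.continuous_im.comp_continuousOn hF) (by fun_prop)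
    rw [← restrict_Ioo_eq_restrict_Icc]
    filter_upwards [hFk, hi] with x h1 h2
    rw [← h1, h2]
  have a0 := hFr (left_mem_Icc.2 zero_le_one)
  have a1 := hFr (right_mem_Icc.2 zero_le_one)
  have b0 := hFi (left_mem_Icc.2 zero_le_one)
  have b1 := hFi (right_mem_Icc.2 zero_le_one)
  simp only [hF0, hF1, Complex.zero_re, Complex.zero_im] at a0 a1 b0 b1
  refine Lp.ext ?_
  filter_upwards [hr, hi, Lp.coeFn_zero ℂ 2 intervalMeasure] with x h1 h2 h3
  have e1 : α = 0 := by linarith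
  have e2 : γ = 0 := by linarith
  have e3 : β = 0 := by linarith
  have e4 : δ = 0 := by linarith
  rw [h3]
  exact Complex.ext (by simp [h1, e1, e3]) (by simp [h2, e2, e4])

lemma HasWeakSecondDeriv.add {f g h k : L2} (H : HasWeakSecondDeriv f h)
    (K : HasWeakSecondDeriv g k) : HasWeakSecondDeriv (f + g) (h + k) := by
  rw [hasWeakSecondDeriv_iff] at *
  intro φ hφ
  rw [inner_add_right, inner_add_right, H φ hφ, K φ hφ]

lemma VanishesAtEndpoints.add {f g : L2} (hf : VanishesAtEndpoints f)
    (hg : VanishesAtEndpoints g) : VanishesAtEndpoints (f + g) := by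
  obtain ⟨F, F1, F2, F3, F4⟩ := hf
  obtain ⟨G, G1, G2, G3, G4⟩ := hg
  refine ⟨F + G, F1.add G1, ?_, by simp [F3, G3], by simp [F4, G4]⟩
  filter_upwards [F2, G2, Lp.coeFn_add f g] with x h1 h2 h3
  rw [h3, Pi.add_apply, Pi.add_apply, h1, h2]

lemma VanishesAtEndpoints.neg {f : L2} (hf : VanishesAtEndpoints f) :
    VanishesAtEndpoints (-f) := by
  obtain ⟨F, F1, F2, F3, F4⟩ := hf
  refine ⟨-F, F1.neg, ?_, by simp [F3], by simp [F4]⟩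
  filter_upwards [F2, Lp.coeFn_neg f] with x h1 h3
  rw [h3, Pi.neg_apply, Pi.neg_apply, h1]

lemma vanishesAtEndpoints_green (h : L2) : VanishesAtEndpoints (green h) :=
  vanishesAtEndpoints_primitiveZero _

/-- The Dirichlet problem `f'' = h`, `f(0) = f(1) = 0` is solved by the Green operator. -/
lemma eq_green_neg {f h : L2} (hf : VanishesAtEndpoints f) (H : HasWeakSecondDeriv f h) :
    f = green (-h) := by
  have h1 : HasWeakSecondDeriv (f + green h) 0 := by
    simpa using H.add (hasWeakSecondDeriv_green h)
  have := eq_zero_of_hasWeakSecondDeriv_zero h1 (hf.add (vanishesAtEndpoints_green h))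
  rw [map_neg, ← add_eq_zero_iff_eq_neg, this]

/-- Replaces the differential operator by an equation between bounded operators; linearity, symmetry
and the resolvent are all derived from this form. -/
lemma isSturmLiouville_iff {q : LInf} {f g : L2} :
    IsSturmLiouville q f g ↔ f = green (g - q • f) := by
  constructor
  · rintro ⟨h1, h, h2, rfl⟩
    rw [add_sub_cancel_right]
    exact eq_green_neg h1 h2
  · intro h
    refine ⟨h ▸ vanishesAtEndpoints_green _, -(g - q • f), ?_, by abel⟩
    have := hasWeakSecondDeriv_green (g - q • f)
    rwa [← h] at this

/-- The weak second derivative of `green h` is `-h`; if `green h = 0`, then `h` annihilates every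
test function. -/
lemma green_injective : Function.Injective green := by
  rw [injective_iff_map_eq_zero]
  intro h hh
  have hw := hasWeakSecondDeriv_green h
  rw [hh, hasWeakSecondDeriv_iff] at hw
  have key := isOpen_Ioo.ae_eq_zero_of_integral_contDiff_smul_eq_zero (U := Ioo (0 : ℝ) 1)
    (μ := volume) (f := h) (IntegrableOn.locallyIntegrableOn (integrable_coeFn h))
    (fun g g1 g2 g3 => ?_)
  · refine Lp.ext ?_
    filter_upwards [(ae_restrict_iff' measurableSet_Ioo).2 key, Lp.coeFn_zero ℂ 2 intervalMeasure]
      with x h1 h2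
    rw [h1, h2]; rfl
  · have hg : IsTest g := ⟨g1, g2, g3⟩
    have := hw g hg
    rw [inner_zero_right, inner_neg_right, IsTest.inner_toL2, zero_eq_neg] at this
    rw [← setIntegral_eq_integral_of_forall_compl_eq_zero (s := Ioo (0 : ℝ) 1)
      (fun x hx => by rw [hg.eq_zero hx, zero_smul]), this]

/-! ### Multiplication operators -/

/-- Multiplication by a bounded function, as an operator on `L²(0,1)`. -/
noncomputable def mulL (q : LInf) : L2 →L[ℂ] L2 :=
  LinearMap.mkContinuous
    { toFun := fun f => q • f
      map_add' := Lp.add_smul q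
      map_smul' := fun c f => by
        refine Lp.ext ?_
        filter_upwards [Lp.coeFn_lpSMul (r := 2) q f, Lp.coeFn_lpSMul (r := 2) q (c • f),
          Lp.coeFn_smul c f, Lp.coeFn_smul c (q • f : L2)] with x h1 h2 h3 h4
        rw [h2, RingHom.id_apply, h4, Pi.smul_apply, h1, Pi.smul_apply', Pi.smul_apply', h3,
          Pi.smul_apply, smul_comm] }
    ‖q‖ (Lp.norm_smul_le q)

lemma mulL_apply (q : LInf) (f : L2) : mulL q f = q • f := rfl

lemma inner_mulL (q : LInf) (f g : L2) : inner ℂ (mulL q f) g = inner ℂ f (mulL q g) := by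
  rw [L2.inner_def, L2.inner_def]
  refine integral_congr_ae ?_
  filter_upwards [Lp.coeFn_lpSMul (r := 2) q f, Lp.coeFn_lpSMul (r := 2) q g] with x h1 h2
  rw [mulL_apply, mulL_apply, h1, h2]
  simp only [Pi.smul_apply', inner_smul_left_eq_smul, inner_smul_right_eq_smul]

lemma re_inner_mulL_nonneg {a : LInf} (ha : 0 ≤ a) (f : L2) : 0 ≤ (inner ℂ f (mulL a f)).re := by
  have e := integral_re (L2.integrable_inner (𝕜 := ℂ) f (mulL a f))
  simp only [RCLike.re_eq_complex_re] at e
  rw [L2.inner_def, ← e]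
  refine integral_nonneg_of_ae ?_
  have h0 : 0 ≤ᵐ[intervalMeasure] a := (Lp.coeFn_nonneg a).2 ha
  filter_upwards [Lp.coeFn_lpSMul (r := 2) a f, h0] with x h1 h2
  rw [mulL_apply, h1]
  simp only [Pi.smul_apply', inner_smul_right_eq_smul, Pi.zero_apply, Complex.smul_re,
    smul_eq_mul] at h2 ⊢
  exact mul_nonneg h2 (inner_self_nonneg (𝕜 := ℂ) (x := f x))

/-! ### Eigenfunction expansions -/

/-- A compact symmetric operator on a Hilbert space has a Hilbert basis of eigenvectors. -/
theorem exists_hilbertBasis_eigenvectors.{v} {H : Type v} [NormedAddCommGroup H]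
    [InnerProductSpace ℂ H] [CompleteSpace H] (T : H →L[ℂ] H) (hT : IsCompactOperator T)
    (hs : (T : H →ₗ[ℂ] H).IsSymmetric) :
    ∃ (ι : Type v) (b : HilbertBasis ι ℂ H) (ν : ι → ℝ), ∀ i, T (b i) = (ν i : ℂ) • b i := by
  let E : ℂ → Submodule ℂ H := fun μ => Module.End.eigenspace (T : H →ₗ[ℂ] H) μ
  have hcl (μ : ℂ) : IsClosed (E μ : Set H) := by
    have : (E μ : Set H) = {x | T x = μ • x} := by
      ext x; exact Module.End.mem_eigenspace_iff
    rw [this]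
    exact isClosed_eq T.continuous (continuous_const_smul μ)
  have hc (μ : ℂ) : CompleteSpace (E μ) := (hcl μ).completeSpace_coe
  choose w bw hbw using fun μ => exists_hilbertBasis ℂ (E μ)
  let v : (Σ μ, w μ) → H := fun a => (bw a.1 a.2 : H)
  have hv : Orthonormal ℂ v :=
    OrthogonalFamily.orthonormal_sigma_orthonormal hs.orthogonalFamily_eigenspaces
      fun μ => (bw μ).orthonormal
  -- A vector orthogonal to the bases of all eigenspaces is, by density, orthogonal to the
  -- eigenspaces, including the kernel; the spectral theorem says that it is zero.
  have hbot : (Submodule.span ℂ (range v))ᗮ = ⊥ := by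
    rw [eq_bot_iff, ← ContinuousLinearMap.orthogonalComplement_iSup_eigenspaces_eq_bot hT hs]
    intro x hx
    have hle : ⨆ μ, E μ ≤ (Submodule.span ℂ {x})ᗮ := by
      refine iSup_le fun μ y hy => ?_
      rw [Submodule.mem_orthogonal_singleton_iff_inner_right]
      have : (innerSL ℂ x) ∘L (E μ).subtypeL = 0 := by
        refine ContinuousLinearMap.ext_on (s := range (bw μ)) ?_ ?_
        · rw [Submodule.dense_iff_topologicalClosure_eq_top]
          exact (bw μ).dense_span
        · rintro _ ⟨i, rfl⟩
          have := (Submodule.mem_orthogonal' _ _).1 hx (v ⟨μ, i⟩)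
            (Submodule.subset_span ⟨⟨μ, i⟩, rfl⟩)
          simpa [v] using this
      simpa using DFunLike.congr_fun this ⟨y, hy⟩
    refine (Submodule.mem_orthogonal' _ _).2 fun y hy => ?_
    exact (Submodule.mem_orthogonal_singleton_iff_inner_right).1 (hle hy)
  let b := HilbertBasis.mkOfOrthogonalEqBot hv hbot
  have hb : ⇑b = v := HilbertBasis.coe_mkOfOrthogonalEqBot hv hbot
  have hmem (a : Σ μ, w μ) : T (b a) = a.1 • b a := by
    rw [hb]
    exact Module.End.mem_eigenspace_iff.1 (bw a.1 a.2).2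
  refine ⟨Σ μ, w μ, b, fun a => a.1.re, fun a => ?_⟩
  have hne : b a ≠ 0 := b.orthonormal.ne_zero a
  have : (starRingEnd ℂ) a.1 = a.1 :=
    hs.conj_eigenvalue_eq_self
      (Module.End.hasEigenvalue_of_hasEigenvector ⟨Module.End.mem_eigenspace_iff.2 (hmem a), hne⟩)
  rw [Complex.conj_eq_iff_re.1 this, hmem]

/-- The pre-image under `primitiveZero` of a function in the domain of the operator: up to a
constant this is the derivative. -/
lemma primitiveZero_adjoint {q : LInf} {f g : L2} (h : IsSturmLiouville q f g) :
    primitiveZero (ContinuousLinearMap.adjoint primitiveZero (g - q • f)) = f :=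
  (isSturmLiouville_iff.1 h).symm

/-- The left side is the Dirichlet energy `∫ |f'|²`, so this is `⟨f, 𝓛 f⟩ = ∫ |f'|² + ∫ q |f|²`. -/
lemma norm_sq_adjoint_primitiveZero {q : LInf} {f g : L2} (h : IsSturmLiouville q f g) :
    ‖ContinuousLinearMap.adjoint primitiveZero (g - q • f)‖ ^ 2 =
      (inner ℂ f g).re - (inner ℂ f (mulL q f)).re := by
  rw [← inner_self_eq_norm_sq (𝕜 := ℂ), ContinuousLinearMap.adjoint_inner_right,
    primitiveZero_adjoint h, inner_sub_right]
  rfl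

lemma abs_re_inner_mulL_le (q : LInf) (f : L2) :
    |(inner ℂ f (mulL q f)).re| ≤ ‖q‖ * ‖f‖ ^ 2 := by
  refine (Complex.abs_re_le_norm _).trans ((norm_inner_le_norm _ _).trans ?_)
  have := Lp.norm_smul_le (r := 2) q f
  rw [mulL_apply]
  nlinarith [norm_nonneg f]

lemma norm_sq_adjoint_primitiveZero_le {q : LInf} {f g : L2} (h : IsSturmLiouville q f g) :
    ‖ContinuousLinearMap.adjoint primitiveZero (g - q • f)‖ ^ 2 ≤
      (inner ℂ f g).re + ‖q‖ * ‖f‖ ^ 2 := by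
  rw [norm_sq_adjoint_primitiveZero h]
  linarith [(abs_le.1 (abs_re_inner_mulL_le q f)).1]

/-- The Sturm-Liouville operator is symmetric. -/
lemma IsSturmLiouville.inner_eq {q : LInf} {f g f' g' : L2} (h : IsSturmLiouville q f g)
    (h' : IsSturmLiouville q f' g') : inner ℂ g f' = inner ℂ f g' := by
  have e1 := isSturmLiouville_iff.1 h
  have e2 := isSturmLiouville_iff.1 h'
  have e3 : inner ℂ (g - q • f) f' = inner ℂ f (g' - q • f') := by
    conv_lhs => rw [e2]
    conv_rhs => rw [e1]
    rw [inner_green_left]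
  rw [inner_sub_left, inner_sub_right, ← mulL_apply, ← mulL_apply, inner_mulL] at e3
  exact sub_left_injective e3

lemma IsSturmLiouville.add {q : LInf} {f g f' g' : L2} (h : IsSturmLiouville q f g)
    (h' : IsSturmLiouville q f' g') : IsSturmLiouville q (f + f') (g + g') := by
  rw [isSturmLiouville_iff, ← mulL_apply] at *
  rw [map_add]
  conv_lhs => rw [h, h']
  rw [← map_add]
  congr 1
  abel

lemma IsSturmLiouville.smul {q : LInf} {f g : L2} (h : IsSturmLiouville q f g) (c : ℂ) :
    IsSturmLiouville q (c • f) (c • g) := by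
  rw [isSturmLiouville_iff, ← mulL_apply] at *
  rw [map_smul, ← smul_sub, map_smul, ← h]

lemma IsSturmLiouville.zero (q : LInf) : IsSturmLiouville q 0 0 := by
  rw [isSturmLiouville_iff, ← mulL_apply]
  simp

lemma IsSturmLiouville.sum {q : LInf} {ι : Type*} {f g : ι → L2}
    (h : ∀ i, IsSturmLiouville q (f i) (g i)) (s : Finset ι) :
    IsSturmLiouville q (∑ i ∈ s, f i) (∑ i ∈ s, g i) := by
  classical
  induction s using Finset.induction_on with
  | empty => simpa using IsSturmLiouville.zero q
  | insert a s ha ih => rw [Finset.sum_insert ha, Finset.sum_insert ha]; exact (h a).add ih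

/-- The Dirichlet energy is nonnegative, so `l ‖φ‖²` is at least `-‖q‖ ‖φ‖²`. -/
lemma IsEigenpair.neg_norm_le {q : LInf} {l : ℝ} {φ : L2} (h : IsEigenpair q l φ) : -‖q‖ ≤ l := by
  have h1 := norm_sq_adjoint_primitiveZero_le h.2
  have h2 : (inner ℂ φ ((l : ℂ) • φ)).re = l * ‖φ‖ ^ 2 := by
    rw [inner_smul_right, Complex.re_ofReal_mul, ← inner_self_eq_norm_sq (𝕜 := ℂ)]
    rfl
  rw [h2] at h1
  have h3 : 0 < ‖φ‖ ^ 2 := by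
    have := norm_pos_iff.2 h.1
    positivity
  have h4 : 0 ≤ (l + ‖q‖) * ‖φ‖ ^ 2 := by
    refine le_trans (sq_nonneg _) (h1.trans (le_of_eq (by ring)))
  have := nonneg_of_mul_nonneg_left h4 h3
  linarith

/-- The eigenfunctions of the Sturm-Liouville operator form a Hilbert basis. -/
theorem exists_hilbertBasis_isEigenpair (q : LInf) :
    ∃ (ι : Type) (b : HilbertBasis ι ℂ L2) (l : ι → ℝ), ∀ i, IsEigenpair q (l i) (b i) := by
  let B := primitiveZero
  -- Shifting the potential by `‖q‖` makes it nonnegative.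
  let V : L2 →L[ℂ] L2 := mulL q + (‖q‖ : ℂ) • ContinuousLinearMap.id ℂ L2
  have hVa (x : L2) : V x = mulL q x + (‖q‖ : ℂ) • x := rfl
  have hVs (x y : L2) : inner ℂ (V x) y = inner ℂ x (V y) := by
    simp only [hVa, inner_add_left, inner_add_right, inner_smul_left, inner_smul_right, inner_mulL,
      Complex.conj_ofReal]
  have hVp (x : L2) : 0 ≤ (inner ℂ x (V x)).re := by
    have h1 := (abs_le.1 (abs_re_inner_mulL_le q x)).1
    have h2 : (inner ℂ x x).re = ‖x‖ ^ 2 := inner_self_eq_norm_sq (𝕜 := ℂ) x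
    simp only [hVa, inner_add_right, inner_smul_right, Complex.add_re,
      Complex.re_ofReal_mul, h2]
    linarith
  let A : L2 →L[ℂ] L2 := 1 + ContinuousLinearMap.adjoint B ∘L V ∘L B
  have hAs (x y : L2) : inner ℂ (A x) y = inner ℂ x (A y) := by
    simp [A, inner_add_left, inner_add_right, ContinuousLinearMap.adjoint_inner_right,
      ContinuousLinearMap.adjoint_inner_left, hVs]
  -- Coercivity: `Re⟨A x, x⟩ ≥ ‖x‖²`, whatever the size of `q`.
  have hA : IsUnit A := by
    refine ContinuousLinearMap.isUnit_of_forall_le_norm_inner_map A one_pos fun x => ?_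
    refine le_trans ?_ (Complex.re_le_norm _)
    have h2 : (inner ℂ x x).re = ‖x‖ ^ 2 := inner_self_eq_norm_sq (𝕜 := ℂ) x
    simp only [A, add_apply, one_apply_eq_self,
      ContinuousLinearMap.comp_apply, inner_add_left, ContinuousLinearMap.adjoint_inner_left,
      Complex.add_re, h2, hVs]
    simpa using hVp (B x)
  obtain ⟨U, hU⟩ := hA
  let S : L2 →L[ℂ] L2 := ↑U⁻¹
  have hAS (x : L2) : A (S x) = x := by
    have : A * S = 1 := by rw [← hU]; exact U.mul_inv
    exact DFunLike.congr_fun this x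
  have hSs (x y : L2) : inner ℂ (S x) y = inner ℂ x (S y) := by
    conv_lhs => rw [← hAS y]
    rw [← hAs, hAS]
  let R : L2 →L[ℂ] L2 := B ∘L S ∘L ContinuousLinearMap.adjoint B
  have hRc : IsCompactOperator R := isCompactOperator_primitiveZero.comp_clm _
  have hRs : (R : L2 →ₗ[ℂ] L2).IsSymmetric := fun x y => by
    change inner ℂ (R x) y = inner ℂ x (R y)
    simp only [R, ContinuousLinearMap.comp_apply]
    rw [← ContinuousLinearMap.adjoint_inner_right, hSs, ContinuousLinearMap.adjoint_inner_left]
  -- `R` inverts `𝓛 + ‖q‖`: with `y = S B* g`, the identity `A y = B* g` reads `B* (g - V B y) = y`,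
  -- and `B` is then applied.
  have hRg (g : L2) : R g = green (g - V (R g)) := by
    have h1 := hAS (ContinuousLinearMap.adjoint B g)
    have h2 : ContinuousLinearMap.adjoint B (g - V (R g)) =
        S (ContinuousLinearMap.adjoint B g) := by
      rw [map_sub]
      nth_rewrite 1 [← h1]
      simp [A, R]
    simp only [green, ContinuousLinearMap.comp_apply]
    exact congrArg B h2.symm
  obtain ⟨ι, b, ν, hb⟩ := exists_hilbertBasis_eigenvectors R hRc hRs
  refine ⟨ι, b, fun i => (ν i)⁻¹ - ‖q‖, fun i => ⟨b.orthonormal.ne_zero i, ?_⟩⟩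
  have h1 := hRg (b i)
  rw [hb] at h1
  -- If `ν i = 0`, then `green (b i) = 0`, against injectivity.
  have hν : (ν i : ℂ) ≠ 0 := by
    intro h0
    rw [h0, zero_smul, map_zero, sub_zero] at h1
    exact b.orthonormal.ne_zero i (green_injective (h1.symm.trans (map_zero _).symm))
  rw [isSturmLiouville_iff, ← mulL_apply]
  have h3 : b i = (ν i : ℂ)⁻¹ • green (b i - V ((ν i : ℂ) • b i)) := by
    rw [← h1, inv_smul_smul₀ hν]
  rw [← map_smul, smul_sub, map_smul, inv_smul_smul₀ hν] at h3
  nth_rewrite 1 [h3]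
  congr 1
  rw [hVa]
  push_cast
  rw [sub_smul]
  abel

/-! ### Fourier coefficients in a basis of eigenfunctions -/

section Basis

variable {ι : Type*} {q : LInf} {b : HilbertBasis ι ℂ L2} {l : ι → ℝ}

lemma inner_basis_isSturmLiouville (hb : ∀ i, IsEigenpair q (l i) (b i)) {f g : L2}
    (h : IsSturmLiouville q f g) (i : ι) : inner ℂ (b i) g = l i * inner ℂ (b i) f := by
  rw [← (hb i).2.inner_eq h, inner_smul_left, Complex.conj_ofReal]

lemma inner_eq_zero_of_isEigenpair (hb : ∀ i, IsEigenpair q (l i) (b i)) {m : ℝ} {φ : L2}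
    (h : IsEigenpair q m φ) {i : ι} (hi : l i ≠ m) : inner ℂ (b i) φ = 0 := by
  have h1 := inner_basis_isSturmLiouville hb h.2 i
  rw [inner_smul_right] at h1
  have h2 : ((m : ℂ) - l i) * inner ℂ (b i) φ = 0 := by rw [sub_mul, h1, sub_self]
  refine (mul_eq_zero.1 h2).resolve_left ?_
  exact sub_ne_zero.2 (by exact_mod_cast hi.symm)

/-- It is enough to test the fractional power on a basis of eigenfunctions. -/
lemma isFractionalPower_of_basis (hb : ∀ i, IsEigenpair q (l i) (b i)) {s : ℝ} {f g : L2}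
    (h : ∀ i, inner ℂ (b i) g = (l i : ℂ) ^ (s : ℂ) * inner ℂ (b i) f) :
    IsFractionalPower q s f g := by
  intro m φ hφ
  rw [← b.tsum_inner_mul_inner, ← b.tsum_inner_mul_inner, ← tsum_mul_left]
  refine tsum_congr fun i => ?_
  -- An eigenfunction for `m` has nonzero coefficients only where `l i = m`, and there the
  -- multiplier is the same constant.
  by_cases hi : l i = m
  · rw [h, hi]; ring
  · rw [← inner_conj_symm, inner_eq_zero_of_isEigenpair hb hφ hi]
    simp

/-- Functions of finite energy satisfy the Dirichlet conditions. -/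
lemma vanishesAtEndpoints_of_summable (hb : ∀ i, IsEigenpair q (l i) (b i)) {u : L2}
    (hu : Summable fun i => |l i| * ‖inner ℂ (b i) u‖ ^ 2) : VanishesAtEndpoints u := by
  set c : ι → ℂ := fun i => inner ℂ (b i) u with hc
  have hcs : HasSum (fun i => c i • b i) u := by
    have := b.hasSum_repr u
    simpa only [b.repr_apply_apply] using this
  -- The derivatives of the terms `c i • b i`. Their sum converges because the Dirichlet energy of a
  -- partial sum is bounded by the weighted coefficients, and `primitiveZero` of the limit is `u`.
  let h : ι → L2 := fun i =>
    ContinuousLinearMap.adjoint primitiveZero (c i • (l i : ℂ) • b i - q • (c i • b i))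
  have hSL (i : ι) : IsSturmLiouville q (c i • b i) (c i • (l i : ℂ) • b i) := (hb i).2.smul _
  have hB (i : ι) : primitiveZero (h i) = c i • b i := primitiveZero_adjoint (hSL i)
  have hsq : Summable fun i => ‖c i‖ ^ 2 := by
    have := b.summable_inner_mul_inner u u
    refine this.norm.congr fun i => ?_
    rw [norm_mul, norm_inner_symm, sq]
  have hall : Summable fun i => (|l i| + ‖q‖) * ‖c i‖ ^ 2 := by
    simp_rw [add_mul]
    exact hu.add (hsq.mul_left _)
  have hbound (t : Finset ι) : ‖∑ i ∈ t, h i‖ ^ 2 ≤ ∑ i ∈ t, (|l i| + ‖q‖) * ‖c i‖ ^ 2 := by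
    have h1 := norm_sq_adjoint_primitiveZero_le (IsSturmLiouville.sum hSL t)
    have h2 : ∑ i ∈ t, h i = ContinuousLinearMap.adjoint primitiveZero
        ((∑ i ∈ t, c i • (l i : ℂ) • b i) - q • (∑ i ∈ t, c i • b i)) := by
      rw [← mulL_apply, map_sum, ← Finset.sum_sub_distrib, map_sum]
      rfl
    rw [← h2] at h1
    refine h1.trans ?_
    have h3 : ‖∑ i ∈ t, c i • b i‖ ^ 2 = ∑ i ∈ t, ‖c i‖ ^ 2 := by
      rw [← inner_self_eq_norm_sq (𝕜 := ℂ), b.orthonormal.inner_sum, map_sum]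
      refine Finset.sum_congr rfl fun i _ => ?_
      rw [← Complex.normSq_eq_conj_mul_self, RCLike.re_eq_complex_re, Complex.ofReal_re,
        Complex.sq_norm]
    have h4 : (inner ℂ (∑ i ∈ t, c i • b i) (∑ i ∈ t, c i • (l i : ℂ) • b i)).re =
        ∑ i ∈ t, l i * ‖c i‖ ^ 2 := by
      simp_rw [smul_smul]
      rw [b.orthonormal.inner_sum, Complex.re_sum]
      refine Finset.sum_congr rfl fun i _ => ?_
      rw [← mul_assoc, ← Complex.normSq_eq_conj_mul_self, ← Complex.ofReal_mul, Complex.ofReal_re,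
        Complex.sq_norm, mul_comm]
    rw [h3, h4, Finset.mul_sum, ← Finset.sum_add_distrib]
    refine Finset.sum_le_sum fun i _ => ?_
    rw [← add_mul]
    gcongr
    exact le_abs_self _
  have hsum : Summable h := by
    rw [summable_iff_vanishing_norm]
    intro ε hε
    obtain ⟨s, hs⟩ := summable_iff_vanishing_norm.1 hall (ε ^ 2) (by positivity)
    refine ⟨s, fun t ht => ?_⟩
    have h1 := (hbound t).trans_lt ((le_abs_self _).trans_lt (hs t ht))
    exact lt_of_pow_lt_pow_left₀ 2 hε.le h1
  have := hsum.hasSum.mapL primitiveZero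
  simp_rw [hB] at this
  rw [hcs.unique this]
  exact vanishesAtEndpoints_primitiveZero _

end Basis

/-! ### Diagonal operators in a Hilbert basis -/

section Diagonal

variable {ι H : Type*} [NormedAddCommGroup H] [InnerProductSpace ℂ H] (b : HilbertBasis ι ℂ H)

lemma ext_inner_basis {x y : H} (h : ∀ i, inner ℂ (b i) x = inner ℂ (b i) y) : x = y := by
  refine b.repr.injective (lp.ext (funext fun i => ?_))
  rw [b.repr_apply_apply, b.repr_apply_apply, h]

lemma hasSum_norm_inner_sq (x : H) : HasSum (fun i => ‖inner ℂ (b i) x‖ ^ 2) (‖x‖ ^ 2) := by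
  have h := (b.hasSum_inner_mul_inner x x).mapL Complex.reCLM
  have e : (inner ℂ x x).re = ‖x‖ ^ 2 := inner_self_eq_norm_sq (𝕜 := ℂ) x
  simp only [Complex.reCLM_apply, e] at h
  refine h.congr_fun fun i => ?_
  rw [← inner_conj_symm x, ← Complex.normSq_eq_conj_mul_self, Complex.ofReal_re, Complex.sq_norm]

lemma norm_le_of_norm_inner_le {x y : H} {C : ℝ} (hC : 0 ≤ C)
    (h : ∀ i, ‖inner ℂ (b i) x‖ ≤ C * ‖inner ℂ (b i) y‖) : ‖x‖ ≤ C * ‖y‖ := by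
  refine le_of_sq_le_sq ?_ (by positivity)
  rw [mul_pow]
  refine hasSum_le (fun i => ?_) (hasSum_norm_inner_sq b x)
    ((hasSum_norm_inner_sq b y).mul_left (C ^ 2))
  rw [← mul_pow]
  exact pow_le_pow_left₀ (norm_nonneg _) (h i) 2

lemma exists_diagonal_apply {m : ι → ℂ} {C : ℝ} (hm : ∀ i, ‖m i‖ ≤ C) (x : H) :
    ∃ y : H, ∀ i, inner ℂ (b i) y = m i * inner ℂ (b i) x := by
  have hmem : Memℓp (fun i => m i * inner ℂ (b i) x) 2 := by
    refine memℓp_gen ?_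
    have h1 := (hasSum_norm_inner_sq b x).summable.mul_left (C ^ 2)
    refine h1.of_nonneg_of_le (fun i => by positivity) fun i => ?_
    simp only [ENNReal.toReal_ofNat, Real.rpow_ofNat, norm_mul, mul_pow]
    gcongr
    exact hm i
  refine ⟨b.repr.symm ⟨_, hmem⟩, fun i => ?_⟩
  rw [← b.repr_apply_apply, LinearIsometryEquiv.apply_symm_apply]

/-- A bounded family of multipliers of the coordinates in a Hilbert basis is realised by a bounded
operator. -/
lemma exists_diagonal {m : ι → ℂ} {C : ℝ} (hC : 0 ≤ C) (hm : ∀ i, ‖m i‖ ≤ C) :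
    ∃ D : H →L[ℂ] H, (∀ x i, inner ℂ (b i) (D x) = m i * inner ℂ (b i) x) ∧
      ∀ x, ‖D x‖ ≤ C * ‖x‖ := by
  choose D hD using exists_diagonal_apply b hm
  have hn (x : H) : ‖D x‖ ≤ C * ‖x‖ := norm_le_of_norm_inner_le b hC fun i => by
    rw [hD, norm_mul]
    gcongr
    exact hm i
  refine ⟨LinearMap.mkContinuous ⟨⟨D, fun x y => ?_⟩, fun c x => ?_⟩ C hn, hD, hn⟩
  · refine ext_inner_basis b fun i => ?_
    rw [inner_add_right, hD, hD, hD, inner_add_right, mul_add]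
  · refine ext_inner_basis b fun i => ?_
    change inner ℂ (b i) (D (c • x)) = inner ℂ (b i) (c • D x)
    rw [inner_smul_right, hD, hD, inner_smul_right]
    ring

lemma norm_exp_mul_I (ν t : ℝ) : ‖Complex.exp (ν * t * Complex.I)‖ = 1 := by
  rw [← Complex.ofReal_mul, Complex.norm_exp_ofReal_mul_I]

/-- The unitary group with the frequencies `ν`. -/
noncomputable def phase (ν : ι → ℝ) (t : ℝ) : H →L[ℂ] H :=
  (exists_diagonal b (m := fun i => Complex.exp (ν i * t * Complex.I)) zero_le_one
    fun i => (norm_exp_mul_I (ν i) t).le).choose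

lemma inner_phase (ν : ι → ℝ) (t : ℝ) (x : H) (i : ι) :
    inner ℂ (b i) (phase b ν t x) = Complex.exp (ν i * t * Complex.I) * inner ℂ (b i) x :=
  (exists_diagonal b (m := fun i => Complex.exp (ν i * t * Complex.I)) zero_le_one
    fun i => (norm_exp_mul_I (ν i) t).le).choose_spec.1 x i

lemma norm_phase (ν : ι → ℝ) (t : ℝ) (x : H) : ‖phase b ν t x‖ = ‖x‖ := by
  refine le_antisymm ?_ ?_
  · simpa using norm_le_of_norm_inner_le b (x := phase b ν t x) (y := x) zero_le_one fun i => by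
      rw [inner_phase, norm_mul, norm_exp_mul_I]
  · simpa using norm_le_of_norm_inner_le b (x := x) (y := phase b ν t x) zero_le_one fun i => by
      rw [inner_phase, norm_mul, norm_exp_mul_I, one_mul, one_mul]

lemma phase_zero (ν : ι → ℝ) (x : H) : phase b ν 0 x = x :=
  ext_inner_basis b fun i => by rw [inner_phase]; simp

lemma continuous_phase_apply (ν : ι → ℝ) (x : H) : Continuous fun t => phase b ν t x := by
  rw [continuous_iff_continuousAt]
  intro s
  rw [ContinuousAt, tendsto_iff_norm_sub_tendsto_zero]
  have h1 (t : ℝ) : ‖phase b ν t x - phase b ν s x‖ ^ 2 =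
      ∑' i, ‖(Complex.exp (ν i * t * Complex.I) - Complex.exp (ν i * s * Complex.I)) *
        inner ℂ (b i) x‖ ^ 2 := by
    rw [← (hasSum_norm_inner_sq b _).tsum_eq]
    refine tsum_congr fun i => ?_
    rw [inner_sub_right, inner_phase, inner_phase, sub_mul]
  have h2 : Tendsto (fun t => ‖phase b ν t x - phase b ν s x‖ ^ 2) (𝓝 s) (𝓝 0) := by
    simp_rw [h1]
    have h3 : (0 : ℝ) = ∑' i : ι, (0 : ℝ) := by simp
    rw [h3]
    -- Each squared term is at most `4 |⟨b i, x⟩|²`, since both exponentials have modulus one.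
    refine tendsto_tsum_of_dominated_convergence
      ((hasSum_norm_inner_sq b x).summable.mul_left 4) (fun i => ?_) (Eventually.of_forall fun t i => ?_)
    · have : Continuous fun t : ℝ => ‖(Complex.exp (ν i * t * Complex.I) -
        Complex.exp (ν i * s * Complex.I)) * inner ℂ (b i) x‖ ^ 2 := by fun_prop
      simpa using this.tendsto s
    · rw [norm_mul, mul_pow, norm_mul, norm_pow, norm_pow, norm_norm, norm_norm]
      gcongr
      have := norm_sub_le (Complex.exp (ν i * t * Complex.I)) (Complex.exp (ν i * s * Complex.I))
      rw [norm_exp_mul_I, norm_exp_mul_I] at this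
      nlinarith [norm_nonneg
        (Complex.exp (ν i * t * Complex.I) - Complex.exp (ν i * s * Complex.I))]
  have h4 := h2.sqrt
  simpa [Real.sqrt_sq (norm_nonneg _)] using h4

/-- The frequencies may be unbounded, so continuity in operator norm is not available; strong
continuity together with the isometry property gives joint continuity. -/
lemma continuous_phase (ν : ι → ℝ) : Continuous fun p : ℝ × H => phase b ν p.1 p.2 := by
  rw [continuous_iff_continuousAt]
  rintro ⟨s, x⟩
  rw [ContinuousAt, tendsto_iff_norm_sub_tendsto_zero]
  refine squeeze_zero (g := fun p : ℝ × H => ‖p.2 - x‖ + ‖phase b ν p.1 x - phase b ν s x‖)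
    (fun _ => norm_nonneg _) (fun p => ?_) ?_
  · have : phase b ν p.1 p.2 - phase b ν s x =
        phase b ν p.1 (p.2 - x) + (phase b ν p.1 x - phase b ν s x) := by
      rw [map_sub]; abel
    rw [this]
    refine (norm_add_le _ _).trans ?_
    rw [norm_phase]
  · have : Continuous fun p : ℝ × H => ‖p.2 - x‖ + ‖phase b ν p.1 x - phase b ν s x‖ :=
      (continuous_snd.sub continuous_const).norm.add
        (((continuous_phase_apply b ν x).comp continuous_fst).sub continuous_const).norm
    simpa using this.tendsto (s, x)

/-- A curve whose coordinates are differentiable, with the coordinates of a continuous curve as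
derivatives, is differentiable. -/
lemma hasDerivWithinAt_of_inner_basis [CompleteSpace H] {T : ℝ} (hT : 0 ≤ T) {y g : ℝ → H}
    (hg : ContinuousOn g (Icc 0 T))
    (h : ∀ i, ∀ t ∈ Icc 0 T, HasDerivWithinAt (fun t => inner ℂ (b i) (y t))
      (inner ℂ (b i) (g t)) (Icc 0 T) t) :
    ∀ t ∈ Icc 0 T, HasDerivWithinAt y (g t) (Icc 0 T) t := by
  -- The constant extension of `g` beyond `[0,T]` makes the primitive differentiable on the whole
  -- line. It differs from `y` by a constant, coordinate by coordinate.
  let G : ℝ → H := IccExtend hT ((Icc 0 T).domRestrict g)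
  have hG : Continuous G := continuous_IccExtend_iff.2 hg.domRestrict
  have hGg (t : ℝ) (ht : t ∈ Icc 0 T) : G t = g t := IccExtend_of_mem hT _ ht
  have hd (t : ℝ) : HasDerivAt (fun t => ∫ s in (0 : ℝ)..t, G s) (G t) t :=
    intervalIntegral.integral_hasDerivAt_right (hG.intervalIntegrable _ _)
      (hG.stronglyMeasurableAtFilter _ _) hG.continuousAt
  have key : ∀ t ∈ Icc 0 T, y t = y 0 + ∫ s in (0 : ℝ)..t, G s := by
    intro t ht
    refine ext_inner_basis b fun i => ?_
    have h1 : ∀ t ∈ Icc 0 T, HasDerivWithinAt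
        (fun t => inner ℂ (b i) (y t) - inner ℂ (b i) (∫ s in (0 : ℝ)..t, G s)) 0 (Icc 0 T) t := by
      intro t ht
      have h2 := (hasDerivAt_const t (b i)).inner ℂ (hd t)
      have h3 := (h i t ht).sub h2.hasDerivWithinAt
      simp only [hGg t ht, inner_zero_left, add_zero, sub_self] at h3
      exact h3
    have h4 := (convex_Icc 0 T).norm_image_sub_le_of_norm_hasDerivWithin_le (C := 0) h1
      (fun _ _ => by simp) (left_mem_Icc.2 hT) ht
    simp only [zero_mul, norm_le_zero_iff, sub_eq_zero, intervalIntegral.integral_same,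
      inner_zero_right, sub_zero] at h4
    rw [inner_add_right, ← h4]
    ring
  intro t ht
  have h5 := ((hd t).const_add (y 0)).hasDerivWithinAt (s := Icc 0 T)
  rw [hGg t ht] at h5
  exact h5.congr key (key t ht)

end Diagonal

/-! ### Global solutions of Lipschitz differential equations -/

section ODE

variable {E : Type*} [NormedAddCommGroup E] [NormedSpace ℝ E] [CompleteSpace E]

/-- A differential equation with a continuous, globally Lipschitz right hand side has a solution on
the whole of any compact interval. -/
theorem exists_solution_of_lipschitz {T : ℝ} (hT : 0 ≤ T) {A : ℝ → E → E} {K : ℝ} (hK : 0 ≤ K)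
    (hA : Continuous fun p : ℝ × E => A p.1 p.2)
    (hL : ∀ t x y, ‖A t x - A t y‖ ≤ K * ‖x - y‖) (y₀ : E) :
    ∃ y : ℝ → E, y 0 = y₀ ∧ ∀ t ∈ Icc 0 T, HasDerivWithinAt y (A t (y t)) (Icc 0 T) t := by
  -- Picard iteration for the rescaled unknown `x(t) = e^{-kt} y(t)`: the contraction factor is `K /
  -- k ≤ 1/2` however long the interval is, and `k > 0` even when `K = 0`.
  let k : ℝ := 2 * K + 1
  have hk : 0 < k := by positivity
  have hne : Nonempty (Icc (0 : ℝ) T) := ⟨⟨0, left_mem_Icc.2 hT⟩⟩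
  let f : C(Icc (0 : ℝ) T, E) → ℝ → E := fun x s => A s (Real.exp (k * s) • IccExtend hT x s)
  have hf (x : C(Icc (0 : ℝ) T, E)) : Continuous (f x) := by
    have : Continuous (IccExtend hT x) := x.continuous.Icc_extend'
    exact hA.comp (continuous_id.prodMk (by fun_prop))
  have hd (x : C(Icc (0 : ℝ) T, E)) (t : ℝ) :
      HasDerivAt (fun t => ∫ s in (0 : ℝ)..t, f x s) (f x t) t :=
    intervalIntegral.integral_hasDerivAt_right ((hf x).intervalIntegrable _ _)
      ((hf x).stronglyMeasurableAtFilter _ _) (hf x).continuousAt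
  have hc (x : C(Icc (0 : ℝ) T, E)) : Continuous fun t => ∫ s in (0 : ℝ)..t, f x s :=
    continuous_iff_continuousAt.2 fun t => (hd x t).continuousAt
  let Φ : C(Icc (0 : ℝ) T, E) → C(Icc (0 : ℝ) T, E) := fun x =>
    ⟨fun t => Real.exp (-(k * t)) • (y₀ + ∫ s in (0 : ℝ)..t, f x s), by
      have := (hc x).comp (continuous_subtype_val (p := fun t => t ∈ Icc (0 : ℝ) T))
      fun_prop⟩
  have hΦ : ContractingWith (1 / 2) Φ := by
    refine ⟨by norm_num, LipschitzWith.of_dist_le_mul fun x x' => ?_⟩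
    rw [ContinuousMap.dist_le (by positivity)]
    rintro ⟨t, ht⟩
    have h1 : ‖(∫ s in (0 : ℝ)..t, f x s) - ∫ s in (0 : ℝ)..t, f x' s‖ ≤
        ∫ s in (0 : ℝ)..t, K * dist x x' * Real.exp (k * s) := by
      rw [← intervalIntegral.integral_sub ((hf x).intervalIntegrable _ _)
        ((hf x').intervalIntegrable _ _)]
      refine intervalIntegral.norm_integral_le_of_norm_le ht.1 (ae_of_all _ fun s _ => ?_)
        (Continuous.intervalIntegrable (by fun_prop) _ _)
      refine (hL _ _ _).trans ?_
      rw [← smul_sub, norm_smul, Real.norm_of_nonneg (Real.exp_pos _).le, mul_assoc,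
        mul_comm (Real.exp _)]
      gcongr
      rw [← dist_eq_norm]
      exact ContinuousMap.dist_apply_le_dist _
    have h2 : ∫ s in (0 : ℝ)..t, K * dist x x' * Real.exp (k * s) =
        K * dist x x' * (Real.exp (k * t) / k - 1 / k) := by
      rw [intervalIntegral.integral_const_mul]
      congr 1
      have h3 (s : ℝ) : HasDerivAt (fun s => Real.exp (k * s) / k) (Real.exp (k * s)) s := by
        have := (((hasDerivAt_id s).const_mul k).exp).div_const k
        simpa [hk.ne'] using this
      rw [intervalIntegral.integral_eq_sub_of_hasDerivAt (fun s _ => h3 s)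
        (Continuous.intervalIntegrable (by fun_prop) _ _)]
      simp
    rw [dist_eq_norm]
    simp only [Φ, ContinuousMap.coe_mk, ← smul_sub, add_sub_add_left_eq_sub]
    rw [norm_smul, Real.norm_of_nonneg (Real.exp_pos _).le]
    rw [h2] at h1
    calc Real.exp (-(k * t)) * ‖(∫ s in (0 : ℝ)..t, f x s) - ∫ s in (0 : ℝ)..t, f x' s‖
        ≤ Real.exp (-(k * t)) * (K * dist x x' * (Real.exp (k * t) / k - 1 / k)) := by gcongr
      _ ≤ Real.exp (-(k * t)) * (K * dist x x' * (Real.exp (k * t) / k)) := by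
          gcongr
          have : 0 ≤ 1 / k := by positivity
          linarith
      _ = K / k * dist x x' := by
          rw [Real.exp_neg]
          have := (Real.exp_pos (k * t)).ne'
          field_simp
      _ ≤ ((1 / 2 : NNReal) : ℝ) * dist x x' := by
          gcongr
          rw [div_le_iff₀ hk]
          simp only [NNReal.coe_div, NNReal.coe_one, NNReal.coe_ofNat, k]
          linarith
  let x := ContractingWith.fixedPoint Φ hΦ
  have hx : Φ x = x := hΦ.fixedPoint_isFixedPt
  refine ⟨fun t => y₀ + ∫ s in (0 : ℝ)..t, f x s, by simp, fun t ht => ?_⟩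
  have h1 := ((hd x t).const_add y₀).hasDerivWithinAt (s := Icc 0 T)
  have h2 : f x t = A t (y₀ + ∫ s in (0 : ℝ)..t, f x s) := by
    have h3 : x ⟨t, ht⟩ = Real.exp (-(k * t)) • (y₀ + ∫ s in (0 : ℝ)..t, f x s) :=
      (DFunLike.congr_fun hx ⟨t, ht⟩).symm
    simp only [f]
    rw [IccExtend_of_mem hT _ ht, h3, smul_smul, ← Real.exp_add]
    simp [f]
  rw [h2] at h1
  exact h1

end ODE

/-! ### First order systems with a diagonal skew-adjoint part -/

section FirstOrder

variable {ι H : Type*} [NormedAddCommGroup H] [InnerProductSpace ℂ H]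
  (b : HilbertBasis ι ℂ H)

/-- The system `p' = ν r`, `r' = -ν p + F`, coordinate by coordinate in the basis `b`. -/
structure IsOscillator (ν : ι → ℝ) (T : ℝ) (p r F : ℝ → H) : Prop where
  cont_fst : ContinuousOn p (Icc 0 T)
  cont_snd : ContinuousOn r (Icc 0 T)
  cont_force : ContinuousOn F (Icc 0 T)
  deriv_fst : ∀ i, ∀ t ∈ Icc 0 T, HasDerivWithinAt (fun t => inner ℂ (b i) (p t))
    (ν i * inner ℂ (b i) (r t)) (Icc 0 T) t
  deriv_snd : ∀ i, ∀ t ∈ Icc 0 T, HasDerivWithinAt (fun t => inner ℂ (b i) (r t))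
    (-(ν i * inner ℂ (b i) (p t)) + inner ℂ (b i) (F t)) (Icc 0 T) t

lemma continuousOn_phase (ν : ι → ℝ) {s : Set ℝ} {τ : ℝ → ℝ} {z : ℝ → H} (hτ : ContinuousOn τ s)
    (hz : ContinuousOn z s) : ContinuousOn (fun t => phase b ν (τ t) (z t)) s :=
  (continuous_phase b ν).comp_continuousOn (f := fun t => (τ t, z t)) (hτ.prodMk hz)

variable {b}

/-- Statements about `p + i r` thereby yield those about `p - i r`. -/
lemma IsOscillator.reflect {ν : ι → ℝ} {T : ℝ} {p r F : ℝ → H} (h : IsOscillator b ν T p r F) :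
    IsOscillator b (fun i => -ν i) T p (fun t => -r t) (fun t => -F t) where
  cont_fst := h.cont_fst
  cont_snd := h.cont_snd.neg
  cont_force := h.cont_force.neg
  deriv_fst := fun i t ht => by simpa using h.deriv_fst i t ht
  deriv_snd := fun i t ht => by
    simp only [inner_neg_right]
    refine (h.deriv_snd i t ht).neg.congr_deriv ?_
    push_cast
    ring

lemma hasDerivAt_exp_mul_I (ν t : ℝ) : HasDerivAt (fun t : ℝ => Complex.exp (ν * t * Complex.I))
    (ν * Complex.I * Complex.exp (ν * t * Complex.I)) t := by
  have h1 : HasDerivAt (fun t : ℝ => (ν : ℂ) * t * Complex.I) (ν * Complex.I) t := by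
    have := ((hasDerivAt_id t).ofReal_comp.const_mul (ν : ℂ)).mul_const Complex.I
    simpa using this
  have := h1.cexp
  rwa [mul_comm] at this

lemma inner_phase_phase (ν : ι → ℝ) (t : ℝ) (x y : H) :
    inner ℂ (phase b ν t x) (phase b ν t y) = inner ℂ x y :=
  LinearIsometry.inner_map_map ⟨(phase b ν t : H →ₗ[ℂ] H), norm_phase b ν t⟩ x y

/-- In coordinates `(p + i r)' = -iν (p + i r) + i F`, and the factor `e^{iνt}` cancels the
unbounded term. What remains is continuous, so the derivative exists in norm. -/
lemma IsOscillator.hasDerivWithinAt_phase [CompleteSpace H] {ν : ι → ℝ} {T : ℝ} {p r F : ℝ → H} (hT : 0 ≤ T)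
    (h : IsOscillator b ν T p r F) : ∀ t ∈ Icc 0 T,
    HasDerivWithinAt (fun t => phase b ν t (p t + Complex.I • r t))
      (phase b ν t (Complex.I • F t)) (Icc 0 T) t := by
  refine hasDerivWithinAt_of_inner_basis b hT ?_ fun i t ht => ?_
  · exact continuousOn_phase b ν continuousOn_id (h.cont_force.const_smul Complex.I)
  · simp only [inner_phase, inner_add_right, inner_smul_right]
    have := (hasDerivAt_exp_mul_I (ν i) t).hasDerivWithinAt (s := Icc 0 T) |>.mul
      ((h.deriv_fst i t ht).add ((h.deriv_snd i t ht).const_mul Complex.I))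
    refine this.congr_deriv ?_
    simp only [Pi.add_apply]
    linear_combination (ν i * Complex.exp (ν i * t * Complex.I) * inner ℂ (b i) (r t)) *
      Complex.I_mul_I

/-- The phase is isometric, so the norm may be computed on the rotated curve, which is
differentiable although `p` and `r` need not be. -/
lemma IsOscillator.hasDerivWithinAt_norm_sq [CompleteSpace H] {ν : ι → ℝ} {T : ℝ} {p r F : ℝ → H} (hT : 0 ≤ T)
    (h : IsOscillator b ν T p r F) : ∀ t ∈ Icc 0 T,
    HasDerivWithinAt (fun t => ‖p t + Complex.I • r t‖ ^ 2)
      (2 * (inner ℂ (p t + Complex.I • r t) (Complex.I • F t)).re) (Icc 0 T) t := by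
  intro t ht
  have h1 := h.hasDerivWithinAt_phase hT t ht
  have h2 := Complex.reCLM.hasFDerivAt.comp_hasDerivWithinAt t (h1.inner ℂ h1)
  have h3 : (fun t => ‖p t + Complex.I • r t‖ ^ 2) = Complex.reCLM ∘ fun t =>
      inner ℂ (phase b ν t (p t + Complex.I • r t)) (phase b ν t (p t + Complex.I • r t)) := by
    ext t
    rw [← norm_phase b ν t, ← inner_self_eq_norm_sq (𝕜 := ℂ)]
    rfl
  rw [h3]
  refine h2.congr_deriv ?_
  simp only [inner_phase_phase, Complex.reCLM_apply, Complex.add_re]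
  rw [← inner_conj_symm (Complex.I • F t), Complex.conj_re]
  ring

/-- The energy identity. -/
lemma IsOscillator.hasDerivWithinAt_energy [CompleteSpace H] {ν : ι → ℝ} {T : ℝ} {p r F : ℝ → H} (hT : 0 ≤ T)
    (h : IsOscillator b ν T p r F) : ∀ t ∈ Icc 0 T,
    HasDerivWithinAt (fun t => ‖p t‖ ^ 2 + ‖r t‖ ^ 2) (2 * (inner ℂ (r t) (F t)).re)
      (Icc 0 T) t := by
  intro t ht
  have h1 := h.hasDerivWithinAt_norm_sq hT t ht
  have h2 := h.reflect.hasDerivWithinAt_norm_sq hT t ht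
  -- By the parallelogram law, averaging over `p + i r` and `p - i r` removes the cross term.
  have h3 : (fun t => ‖p t‖ ^ 2 + ‖r t‖ ^ 2) = fun t => (1 / 2 : ℝ) *
      (‖p t + Complex.I • r t‖ ^ 2 + ‖p t + Complex.I • -r t‖ ^ 2) := by
    ext t
    have := parallelogram_law_with_norm ℂ (p t) (Complex.I • r t)
    rw [norm_smul, Complex.norm_I, one_mul] at this
    rw [smul_neg, ← sub_eq_add_neg]
    linarith
  rw [h3]
  refine ((h1.add h2).const_mul (1 / 2 : ℝ)).congr_deriv ?_
  simp only [smul_neg, inner_add_left, inner_neg_left, inner_neg_right, inner_smul_left,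
    inner_smul_right, Complex.conj_I, Complex.add_re, Complex.neg_re,
    Complex.add_im, Complex.mul_re,
    Complex.mul_im, Complex.I_re, Complex.I_im, Complex.neg_im]
  ring

variable (b)

/-- Variation of constants: `y = (e^{iνt}(p + i r), e^{-iνt}(p - i r))` solves an equation without
unbounded terms, whose Lipschitz constant is `‖N‖`. -/
theorem exists_isOscillator [CompleteSpace H] (ν : ι → ℝ) {T : ℝ} (hT : 0 ≤ T) (N : H × H →L[ℂ] H) (p₀ r₀ : H) :
    ∃ p r : ℝ → H, IsOscillator b ν T p r (fun t => N (p t, r t)) ∧ p 0 = p₀ ∧ r 0 = r₀ := by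
  obtain ⟨U, hUdef⟩ : ∃ U : ℝ → H →L[ℂ] H, U = phase b ν := ⟨_, rfl⟩
  -- `Z t` recovers `(p, r)` from `y`; it does not increase the maximum norm of the pair.
  obtain ⟨Z, hZ⟩ : ∃ Z : ℝ → H × H → H × H, ∀ t y, Z t y =
    ((1 / 2 : ℂ) • (U (-t) y.1 + U t y.2), (1 / (2 * Complex.I)) • (U (-t) y.1 - U t y.2)) :=
    ⟨_, fun _ _ => rfl⟩
  -- The rotated forces `e^{iνt} i F` and `-e^{-iνt} i F`.
  obtain ⟨A, hA⟩ : ∃ A : ℝ → H × H → H × H, ∀ t y, A t y =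
    (U t (Complex.I • N (Z t y)), U (-t) (-(Complex.I • N (Z t y)))) := ⟨_, fun _ _ => rfl⟩
  have hU : Continuous fun p : ℝ × H => U p.1 p.2 := hUdef ▸ continuous_phase b ν
  have hZc : Continuous fun y : ℝ × (H × H) => Z y.1 y.2 := by
    have h1 : Continuous fun y : ℝ × (H × H) => U (-y.1) y.2.1 :=
      hU.comp (f := fun y : ℝ × (H × H) => (-y.1, y.2.1)) (by fun_prop)
    have h2 : Continuous fun y : ℝ × (H × H) => U y.1 y.2.2 :=
      hU.comp (f := fun y : ℝ × (H × H) => (y.1, y.2.2)) (by fun_prop)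
    simp only [hZ]
    exact ((h1.add h2).const_smul _).prodMk ((h1.sub h2).const_smul _)
  have hAc : Continuous fun y : ℝ × (H × H) => A y.1 y.2 := by
    have h1 : Continuous fun y : ℝ × (H × H) => Complex.I • N (Z y.1 y.2) :=
      (N.continuous.comp hZc).const_smul Complex.I
    simp only [hA]
    exact (hU.comp (f := fun y : ℝ × (H × H) => (y.1, Complex.I • N (Z y.1 y.2)))
      (continuous_fst.prodMk h1)).prodMk
      (hU.comp (f := fun y : ℝ × (H × H) => (-y.1, -(Complex.I • N (Z y.1 y.2))))
        (continuous_fst.neg.prodMk h1.neg))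
  have hZs (t : ℝ) (x y : H × H) : Z t x - Z t y = Z t (x - y) := by
    simp only [hZ, Prod.mk_sub_mk, Prod.fst_sub, Prod.snd_sub, map_sub, ← smul_sub]
    congr 2 <;> abel
  have hUn (t : ℝ) (x : H) : ‖U t x‖ = ‖x‖ := hUdef ▸ norm_phase b ν t x
  have hZn (t : ℝ) (y : H × H) : ‖Z t y‖ ≤ ‖y‖ := by
    have h1 := norm_fst_le y
    have h2 := norm_snd_le y
    refine norm_prod_le_iff.2 ⟨?_, ?_⟩
    · simp only [hZ, norm_smul]
      have := norm_add_le (U (-t) y.1) (U t y.2)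
      rw [hUn, hUn] at this
      norm_num
      linarith
    · simp only [hZ, norm_smul]
      have := norm_sub_le (U (-t) y.1) (U t y.2)
      rw [hUn, hUn] at this
      norm_num
      linarith
  have hAL (t : ℝ) (x y : H × H) : ‖A t x - A t y‖ ≤ ‖N‖ * ‖x - y‖ := by
    have h1 : ‖N (Z t x) - N (Z t y)‖ ≤ ‖N‖ * ‖x - y‖ := by
      rw [← map_sub, hZs]
      exact (N.le_opNorm _).trans (by gcongr; exact hZn _ _)
    refine norm_prod_le_iff.2 ⟨?_, ?_⟩
    · simp only [hA, Prod.fst_sub]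
      rwa [← map_sub, hUn, ← smul_sub, norm_smul, Complex.norm_I, one_mul]
    · simp only [hA, Prod.snd_sub]
      rwa [← map_sub, hUn, ← neg_sub', ← smul_sub, norm_neg, norm_smul, Complex.norm_I, one_mul]
  obtain ⟨y, hy0, hy⟩ := exists_solution_of_lipschitz hT (norm_nonneg N) hAc hAL
    (p₀ + Complex.I • r₀, p₀ - Complex.I • r₀)
  have hyc : ContinuousOn y (Icc 0 T) := fun t ht => (hy t ht).continuousWithinAt
  have hpr : ContinuousOn (fun t => Z t (y t)) (Icc 0 T) :=
    hZc.comp_continuousOn (continuousOn_id.prodMk hyc)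
  have hUi (i : ι) (t : ℝ) (x : H) :
      inner ℂ (b i) (U t x) = Complex.exp (ν i * t * Complex.I) * inner ℂ (b i) x :=
    hUdef ▸ inner_phase b ν t x i
  have hexp (i : ι) (t : ℝ) :
      Complex.exp (ν i * t * Complex.I) * Complex.exp (-(ν i * t * Complex.I)) = 1 := by
    rw [← Complex.exp_add, add_neg_cancel, Complex.exp_zero]
  have hz (i : ι) (t : ℝ) (ht : t ∈ Icc 0 T) :
      HasDerivWithinAt (fun t => inner ℂ (b i) (U (-t) (y t).1))
        (-(ν i * Complex.I * inner ℂ (b i) (U (-t) (y t).1)) +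
          Complex.I * inner ℂ (b i) (N (Z t (y t)))) (Icc 0 T) t := by
    have h1 := (hy t ht).hasFDerivWithinAt.fst.hasDerivWithinAt
    have h2 := (hasDerivAt_exp_mul_I (-ν i) t).hasDerivWithinAt (s := Icc 0 T) |>.mul
      ((hasDerivWithinAt_const t (Icc 0 T) (b i)).inner ℂ h1)
    simp only [hUi]
    push_cast at h2 ⊢
    have e (t : ℝ) : (ν i : ℂ) * -(t : ℂ) * Complex.I = -ν i * t * Complex.I := by ring
    simp only [e]
    refine h2.congr_deriv ?_
    simp [hA, hUi, inner_smul_right]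
    linear_combination (Complex.I * inner ℂ (b i) (N (Z t (y t)))) * hexp i t
  have hw (i : ι) (t : ℝ) (ht : t ∈ Icc 0 T) :
      HasDerivWithinAt (fun t => inner ℂ (b i) (U t (y t).2))
        (ν i * Complex.I * inner ℂ (b i) (U t (y t).2) -
          Complex.I * inner ℂ (b i) (N (Z t (y t)))) (Icc 0 T) t := by
    have h1 := (hy t ht).hasFDerivWithinAt.snd.hasDerivWithinAt
    have h2 := (hasDerivAt_exp_mul_I (ν i) t).hasDerivWithinAt (s := Icc 0 T) |>.mul
      ((hasDerivWithinAt_const t (Icc 0 T) (b i)).inner ℂ h1)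
    simp only [hUi]
    refine h2.congr_deriv ?_
    simp [hA, hUi, inner_smul_right]
    linear_combination (-Complex.I * inner ℂ (b i) (N (Z t (y t)))) * hexp i t
  refine ⟨fun t => (Z t (y t)).1, fun t => (Z t (y t)).2, ⟨hpr.fst, hpr.snd,
    N.continuous.comp_continuousOn hpr, fun i t ht => ?_, fun i t ht => ?_⟩, ?_, ?_⟩
  · have := ((hz i t ht).add (hw i t ht)).const_mul (1 / 2 : ℂ)
    simp only [hZ, inner_smul_right, inner_add_right, inner_sub_right]
    refine this.congr_deriv ?_
    field_simp
    linear_combination (-(ν i * (inner ℂ (b i) (U (-t) (y t).1) - inner ℂ (b i) (U t (y t).2)))) *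
      Complex.I_mul_I
  · change HasDerivWithinAt _ (_ + inner ℂ (b i) (N (Z t (y t)))) _ _
    have := ((hz i t ht).sub (hw i t ht)).const_mul (1 / (2 * Complex.I))
    generalize inner ℂ (b i) (N (Z t (y t))) = c at this ⊢
    simp only [hZ, inner_smul_right, inner_add_right, inner_sub_right]
    refine this.congr_deriv ?_
    field_simp
    ring
  · simp [hZ, hy0, hUdef, phase_zero, ← two_smul ℂ p₀, smul_smul]
  · simp only [hZ, hy0, hUdef, phase_zero, neg_zero]
    rw [add_sub_sub_cancel, ← two_smul ℂ (Complex.I • r₀), smul_smul, smul_smul]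
    simp

end FirstOrder

/-! ### The wave equation in the basis of eigenfunctions -/

lemma inner_eq_inner_of_basis {ι H : Type*} [NormedAddCommGroup H] [InnerProductSpace ℂ H]
    (b : HilbertBasis ι ℂ H) {x y z w : H}
    (h : ∀ i, starRingEnd ℂ (inner ℂ (b i) x) * inner ℂ (b i) y =
      starRingEnd ℂ (inner ℂ (b i) z) * inner ℂ (b i) w) : inner ℂ x y = inner ℂ z w := by
  rw [← b.tsum_inner_mul_inner, ← b.tsum_inner_mul_inner]
  refine tsum_congr fun i => ?_
  rw [← inner_conj_symm x, ← inner_conj_symm z, h]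

lemma _root_.HasDerivWithinAt.const_inner {H : Type*} [NormedAddCommGroup H]
    [InnerProductSpace ℂ H] {y : ℝ → H} {y' : H} {s : Set ℝ} {t : ℝ}
    (h : HasDerivWithinAt y y' s t) (x : H) :
    HasDerivWithinAt (fun t => inner ℂ x (y t)) (inner ℂ x y') s t := by
  simpa using (hasDerivWithinAt_const t s x).inner ℂ h

lemma _root_.HasDerivWithinAt.clm_apply_curve {H : Type*} [NormedAddCommGroup H]
    [InnerProductSpace ℂ H] {y : ℝ → H} {y' : H} {s : Set ℝ} {t : ℝ}
    (h : HasDerivWithinAt y y' s t) (A : H →L[ℂ] H) :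
    HasDerivWithinAt (fun t => A (y t)) (A y') s t :=
  (A.restrictScalars ℝ).hasFDerivAt.comp_hasDerivWithinAt t h

lemma IsSolution.hasDerivWithinAt {T : ℝ} {q a β : LInf} {u₀ u₁ : L2} {u : ℝ → L2}
    (h : IsSolution T q a β u₀ u₁ u) {t : ℝ} (ht : t ∈ Icc 0 T) :
    HasDerivWithinAt u (timeDeriv T u t) (Icc 0 T) t :=
  (h.contDiff.differentiableOn one_ne_zero t ht).hasDerivWithinAt

lemma IsSolution.continuousOn_timeDeriv {T : ℝ} (hT : 0 < T) {q a β : LInf} {u₀ u₁ : L2}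
    {u : ℝ → L2} (h : IsSolution T q a β u₀ u₁ u) : ContinuousOn (timeDeriv T u) (Icc 0 T) :=
  h.contDiff.continuousOn_derivWithin (uniqueDiffOn_Icc hT) le_rfl

/-- The difference of two solutions is a solution with zero initial data. -/
lemma IsSolution.sub {T : ℝ} (hT : 0 < T) {q a β : LInf} {u₀ u₁ : L2} {u v : ℝ → L2}
    (hu : IsSolution T q a β u₀ u₁ u) (hv : IsSolution T q a β u₀ u₁ v) :
    IsSolution T q a β 0 0 (fun t => u t - v t) := by
  have hd (t : ℝ) (ht : t ∈ Icc 0 T) :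
      timeDeriv T (fun t => u t - v t) t = timeDeriv T u t - timeDeriv T v t :=
    ((hu.hasDerivWithinAt ht).sub (hv.hasDerivWithinAt ht)).derivWithin (uniqueDiffOn_Icc hT t ht)
  obtain ⟨hu1, w, hw1, hw2⟩ := hu.continuous_sobolev
  obtain ⟨hv1, z, hz1, hz2⟩ := hv.continuous_sobolev
  have h0 : (0 : ℝ) ∈ Icc 0 T := left_mem_Icc.2 hT.le
  refine ⟨⟨hu1.sub hv1, fun t => w t - z t, fun t ht l φ hφ => ?_, hw2.sub hz2⟩,
    hu.contDiff.sub hv.contDiff, fun ψ Lψ hψ t ht => ?_, ?_, ?_, fun t ht => ?_⟩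
  · rw [inner_sub_right, inner_sub_right, hw1 t ht l φ hφ, hz1 t ht l φ hφ, mul_sub]
  · have h1 := (hu.equation ψ Lψ hψ t ht).sub (hv.equation ψ Lψ hψ t ht)
    have h2 : HasDerivWithinAt (fun τ => inner ℂ ψ (timeDeriv T (fun t => u t - v t) τ))
        _ (Icc 0 T) t := h1.congr (fun τ hτ => by rw [hd τ hτ, inner_sub_right]; rfl)
          (by rw [hd t ht, inner_sub_right]; rfl)
    refine h2.congr_deriv ?_
    rw [hd t ht]
    simp only [← mulL_apply, map_sub, inner_sub_right]
    ring
  · simp [hu.initial, hv.initial]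
  · simp [hd 0 h0, hu.initial_deriv, hv.initial_deriv]
  · simp only [sub_eq_add_neg]
    exact (hu.boundary t ht).add (hv.boundary t ht).neg

/-! ### Energy estimate and construction of the solution -/

section Basis

variable {ι : Type*} {q : LInf} {b : HilbertBasis ι ℂ L2} {l : ι → ℝ} {M : ℝ}

lemma sq_sqrt_shift (hM : ∀ i, 1 ≤ l i + M) (i : ι) :
    ((√(l i + M) : ℝ) : ℂ) * (√(l i + M) : ℝ) = l i + M := by
  rw [← Complex.ofReal_mul, Real.mul_self_sqrt (zero_le_one.trans (hM i))]
  push_cast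
  rfl

lemma norm_cpow_half_le (hM : ∀ i, |l i| ≤ l i + M) (i : ι) :
    ‖(l i : ℂ) ^ ((1 / 2 : ℝ) : ℂ)‖ ≤ √(l i + M) := by
  rw [Complex.norm_cpow_real, Complex.norm_real, ← Real.sqrt_eq_rpow]
  exact Real.sqrt_le_sqrt (hM i)

/-- If `𝓛^{1/2} u` is continuous in time, then so is `(𝓛 + M)^{1/2} u`. -/
lemma exists_continuousOn_sqrt_shift (hb : ∀ i, IsEigenpair q (l i) (b i)) (hM0 : 0 ≤ M)
    {s : Set ℝ} {u w : ℝ → L2} (hu : ContinuousOn u s)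
    (hw : ContinuousOn w s) (h : ∀ t ∈ s, IsFractionalPower q (1 / 2) (u t) (w t)) :
    ∃ p : ℝ → L2, ContinuousOn p s ∧
      ∀ t ∈ s, ∀ i, inner ℂ (b i) (p t) = (√(l i + M) : ℝ) * inner ℂ (b i) (u t) := by
  -- Where `l i ≥ 1`, the coefficient of `p` comes from that of `w`, with ratio `√((l + M) / l) ≤
  -- √(1 + M)`. Elsewhere `l^{1/2}` may vanish, and `D'` takes the coefficient from `u`, with the
  -- same bound.
  obtain ⟨D, hD, -⟩ := exists_diagonal b (C := √(1 + M)) (Real.sqrt_nonneg _)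
    (m := fun i => if 1 ≤ l i then ((√(l i + M) / √(l i) : ℝ) : ℂ) else 0) (fun i => by
      split_ifs with h1
      · rw [Complex.norm_real, Real.norm_of_nonneg (by positivity), ← Real.sqrt_div' _ (by linarith)]
        refine Real.sqrt_le_sqrt ?_
        rw [div_le_iff₀ (by linarith)]
        nlinarith
      · simp)
  obtain ⟨D', hD', -⟩ := exists_diagonal b (C := √(1 + M)) (Real.sqrt_nonneg _)
    (m := fun i => if 1 ≤ l i then 0 else ((√(l i + M) : ℝ) : ℂ)) (fun i => by
      split_ifs with h1
      · simp
      · rw [Complex.norm_real, Real.norm_of_nonneg (by positivity)]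
        refine Real.sqrt_le_sqrt ?_
        linarith)
  refine ⟨fun t => D (w t) + D' (u t), (D.continuous.comp_continuousOn hw).add
    (D'.continuous.comp_continuousOn hu), fun t ht i => ?_⟩
  rw [inner_add_right, hD, hD', h t ht _ _ (hb i)]
  split_ifs with h1
  · have h2 : 0 < √(l i) := Real.sqrt_pos.2 (by linarith)
    rw [← Complex.ofReal_cpow (by linarith), ← Real.sqrt_eq_rpow, ← mul_assoc,
      ← Complex.ofReal_mul, div_mul_cancel₀ _ h2.ne', zero_mul, add_zero]
  · rw [zero_mul, zero_add]

/-- Solutions of the wave equation are oscillators in the basis of eigenfunctions. -/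
lemma IsSolution.exists_isOscillator (hb : ∀ i, IsEigenpair q (l i) (b i)) (hM0 : 0 ≤ M)
    (hM1 : ∀ i, 1 ≤ l i + M) {T : ℝ} (hT : 0 < T) {a β : LInf} {u₀ u₁ : L2} {u : ℝ → L2}
    (h : IsSolution T q a β u₀ u₁ u) : ∃ p : ℝ → L2,
      (∀ t ∈ Icc 0 T, ∀ i, inner ℂ (b i) (p t) = (√(l i + M) : ℝ) * inner ℂ (b i) (u t)) ∧
      IsOscillator b (fun i => √(l i + M)) T p (timeDeriv T u)
        (fun t => (M : ℂ) • u t - mulL a (u t) - mulL β (timeDeriv T u t)) := by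
  obtain ⟨hu, w, hw1, hw2⟩ := h.continuous_sobolev
  obtain ⟨p, hp, hpi⟩ := exists_continuousOn_sqrt_shift hb hM0 hu hw2 hw1
  have hr := h.continuousOn_timeDeriv hT
  have ha : ContinuousOn (fun t => mulL a (u t)) (Icc 0 T) := (mulL a).continuous.comp_continuousOn hu
  have hβ : ContinuousOn (fun t => mulL β (timeDeriv T u t)) (Icc 0 T) :=
    (mulL β).continuous.comp_continuousOn hr
  have hM : ContinuousOn (fun t => (M : ℂ) • u t) (Icc 0 T) := hu.const_smul (M : ℂ)
  refine ⟨p, hpi, hp, hr, (hM.sub ha).sub hβ, fun i t ht => ?_, fun i t ht => ?_⟩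
  · exact (((h.hasDerivWithinAt ht).const_inner (b i)).const_mul _).congr
      (fun t ht => hpi t ht i) (hpi t ht i)
  -- The weak equation tested with `b i`; `M u` is added on both sides.
  · refine (h.equation _ _ (hb i).2 t ht).congr_deriv ?_
    rw [hpi t ht, ← mul_assoc, sq_sqrt_shift hM1]
    simp only [inner_sub_right, inner_smul_right, inner_smul_left, mulL_apply, Complex.conj_ofReal]
    ring

/-- Including `⟨u, a u⟩` in the energy cancels the work done by `a`, and `b` only dissipates. Growth
comes from the shift `M` alone, so the rate is free of `q`, `a` and `b`. -/
theorem IsSolution.exists_energy_le (hb : ∀ i, IsEigenpair q (l i) (b i)) (hM0 : 0 ≤ M)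
    (hM : ∀ i, 1 ≤ l i + M) {T : ℝ} (hT : 0 < T) {a β : LInf} (ha : 0 ≤ a) (hβ : 0 ≤ β)
    {u₀ u₁ : L2} {u : ℝ → L2} (h : IsSolution T q a β u₀ u₁ u) : ∃ p : ℝ → L2,
      (∀ t ∈ Icc 0 T, ∀ i, inner ℂ (b i) (p t) = (√(l i + M) : ℝ) * inner ℂ (b i) (u t)) ∧
      ∀ t ∈ Icc 0 T, ‖p t‖ ^ 2 + ‖timeDeriv T u t‖ ^ 2 ≤
        Real.exp (M * T) * (‖p 0‖ ^ 2 + ‖u₁‖ ^ 2 + (inner ℂ u₀ (mulL a u₀)).re) := by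
  obtain ⟨p, hp, hosc⟩ := h.exists_isOscillator hb hM0 hM hT
  refine ⟨p, hp, ?_⟩
  set r := timeDeriv T u with hr
  let G : ℝ → ℝ := fun t => ‖p t‖ ^ 2 + ‖r t‖ ^ 2 + (inner ℂ (u t) (mulL a (u t))).re
  let G' : ℝ → ℝ := fun t => 2 * (M * (inner ℂ (r t) (u t)).re - (inner ℂ (r t) (mulL β (r t))).re)
  have hG (t : ℝ) (ht : t ∈ Icc 0 T) : HasDerivWithinAt G (G' t) (Icc 0 T) t := by
    have h1 := hosc.hasDerivWithinAt_energy hT.le t ht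
    have h2 := h.hasDerivWithinAt ht
    have h3 := Complex.reCLM.hasFDerivAt.comp_hasDerivWithinAt t
      (h2.inner ℂ (h2.clm_apply_curve (mulL a)))
    refine (h1.add h3).congr_deriv ?_
    simp only [Complex.reCLM_apply, Complex.add_re, inner_sub_right, inner_smul_right,
      Complex.sub_re, Complex.re_ofReal_mul, G']
    have e : (inner ℂ (u t) (mulL a (r t))).re = (inner ℂ (r t) (mulL a (u t))).re := by
      rw [← inner_mulL, ← inner_conj_symm (mulL a (u t)), Complex.conj_re]
    rw [← hr, e]
    ring
  have hu_le (t : ℝ) (ht : t ∈ Icc 0 T) : ‖u t‖ ≤ ‖p t‖ := by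
    have := norm_le_of_norm_inner_le b (x := u t) (y := p t) zero_le_one fun i => by
      rw [hp t ht, norm_mul, one_mul, Complex.norm_real, Real.norm_of_nonneg (Real.sqrt_nonneg _)]
      exact le_mul_of_one_le_left (norm_nonneg _) (Real.one_le_sqrt.2 (hM i))
    rwa [one_mul] at this
  have hG' (t : ℝ) (ht : t ∈ Icc 0 T) : G' t ≤ M * G t := by
    have h1 := re_inner_mulL_nonneg hβ (r t)
    have h2 := re_inner_mulL_nonneg ha (u t)
    have h3 : (inner ℂ (r t) (u t)).re ≤ ‖r t‖ * ‖u t‖ :=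
      (Complex.re_le_norm _).trans (norm_inner_le_norm _ _)
    have h4 : 2 * (inner ℂ (r t) (u t)).re ≤ G t := by
      have h5 : ‖u t‖ ^ 2 ≤ ‖p t‖ ^ 2 := pow_le_pow_left₀ (norm_nonneg _) (hu_le t ht) 2
      simp only [G]
      nlinarith [sq_nonneg (‖r t‖ - ‖u t‖)]
    have := mul_le_mul_of_nonneg_left h4 hM0
    simp only [G']
    linarith
  -- Grönwall's argument: `e^{-Mt} G` does not increase.
  have hanti : AntitoneOn (fun t => Real.exp (-(M * t)) * G t) (Icc 0 T) := by
    have hd (t : ℝ) (ht : t ∈ Icc 0 T) : HasDerivWithinAt (fun t => Real.exp (-(M * t)) * G t)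
        (Real.exp (-(M * t)) * (G' t - M * G t)) (Icc 0 T) t := by
      have h1 : HasDerivAt (fun t => Real.exp (-(M * t))) (Real.exp (-(M * t)) * -(M * 1)) t :=
        ((hasDerivAt_id t).const_mul M).neg.exp
      refine (h1.hasDerivWithinAt.mul (hG t ht)).congr_deriv ?_
      ring
    refine antitoneOn_of_hasDerivWithinAt_nonpos (convex_Icc 0 T)
      (fun t ht => (hd t ht).continuousWithinAt)
      (fun t ht => (hd t (interior_subset ht)).mono interior_subset) fun t ht => ?_
    exact mul_nonpos_of_nonneg_of_nonpos (Real.exp_pos _).le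
      (sub_nonpos.2 (hG' t (interior_subset ht)))
  intro t ht
  have h0 : (0 : ℝ) ∈ Icc 0 T := left_mem_Icc.2 hT.le
  have h1 := hanti h0 ht ht.1
  simp only [mul_zero, neg_zero, Real.exp_zero, one_mul] at h1
  have hG0 : G 0 = ‖p 0‖ ^ 2 + ‖u₁‖ ^ 2 + (inner ℂ u₀ (mulL a u₀)).re := by
    simp only [G, hr, h.initial, h.initial_deriv]
  rw [← hG0]
  have h2 := re_inner_mulL_nonneg ha (u t)
  have h3 : G t ≤ Real.exp (M * t) * G 0 := by
    rw [Real.exp_neg, inv_mul_le_iff₀ (Real.exp_pos _)] at h1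
    exact h1
  have h4 : 0 ≤ G 0 := by
    have := re_inner_mulL_nonneg ha (u 0)
    simp only [G]
    positivity
  have h5 : Real.exp (M * t) * G 0 ≤ Real.exp (M * T) * G 0 := by
    gcongr
    exact ht.2
  have h6 : G t = ‖p t‖ ^ 2 + ‖r t‖ ^ 2 + (inner ℂ (u t) (mulL a (u t))).re := rfl
  linarith

/-- The initial energy is at most `(1 + q + a + M) N² ≤ (1 + M) K N²`. As `C K ≥ 1`, the factor `C
K` is at most its square, so taking roots gives the product form without fractional powers. -/
lemma energy_arith {q a β M T n₀ n₂ n₁ p₀ α x y : ℝ} (hq : 0 ≤ q) (ha : 0 ≤ a) (hβ : 0 ≤ β)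
    (hM : 0 ≤ M) (hT : 0 ≤ T) (h₀ : 0 ≤ n₀) (h₂ : 0 ≤ n₂) (h₁ : 0 ≤ n₁)
    (hp : p₀ ^ 2 ≤ n₀ * (n₂ + q * n₀ + M * n₀)) (hα : α ≤ a * n₀ ^ 2)
    (h : x ^ 2 + y ^ 2 ≤ Real.exp (M * T) * (p₀ ^ 2 + n₁ ^ 2 + α)) :
    x ≤ Real.exp (M * T) * (1 + M) * ((1 + q) * (1 + a) * (1 + β) * (n₀ + n₂ + n₁)) ∧
    y ≤ Real.exp (M * T) * (1 + M) * ((1 + q) * (1 + a) * (1 + β) * (n₀ + n₂ + n₁)) := by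
  set N := n₀ + n₂ + n₁ with hN
  set K := (1 + q) * (1 + a) * (1 + β) with hK
  have hK1 : 1 + q + a ≤ K := by
    have h1 : (1 + q) * (1 + a) ≤ K := le_mul_of_one_le_right (by positivity) (by linarith)
    linarith [mul_nonneg hq ha]
  have hK2 : 1 ≤ K := by linarith
  have hG0 : p₀ ^ 2 + n₁ ^ 2 + α ≤ (1 + M) * K * N ^ 2 := by
    have e1 : n₀ * n₂ + n₀ ^ 2 + n₁ ^ 2 ≤ N ^ 2 := by
      have : N ^ 2 = n₀ * n₂ + n₀ ^ 2 + n₁ ^ 2 +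
        (n₀ * n₂ + n₂ ^ 2 + 2 * (n₀ * n₁) + 2 * (n₂ * n₁)) := by rw [hN]; ring
      rw [this]
      exact le_add_of_nonneg_right (by positivity)
    have e2 : n₀ ^ 2 ≤ N ^ 2 := pow_le_pow_left₀ h₀ (by linarith) 2
    have e3 : (q + a + M) * n₀ ^ 2 ≤ (q + a + M) * N ^ 2 := by gcongr
    have e4 : (1 + q + a + M) * N ^ 2 ≤ (1 + M) * K * N ^ 2 := by
      gcongr
      linarith [mul_nonneg hM (sub_nonneg.2 hK2)]
    linarith [sq_nonneg n₀]
  set C := Real.exp (M * T) * (1 + M) with hC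
  have hC1 : 1 ≤ C := one_le_mul_of_one_le_of_one_le (Real.one_le_exp (by positivity)) (by linarith)
  have hfin : x ^ 2 + y ^ 2 ≤ (C * (K * N)) ^ 2 := by
    calc x ^ 2 + y ^ 2
        ≤ Real.exp (M * T) * ((1 + M) * K * N ^ 2) := h.trans (by gcongr)
      _ = (C * K) * N ^ 2 := by rw [hC]; ring
      _ ≤ (C * K) ^ 2 * N ^ 2 := by
          gcongr
          exact le_self_pow₀ (one_le_mul_of_one_le_of_one_le hC1 hK2) two_ne_zero
      _ = (C * (K * N)) ^ 2 := by ring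
  have hpos : 0 ≤ C * (K * N) := by positivity
  exact ⟨le_of_sq_le_sq (by linarith [sq_nonneg y]) hpos,
    le_of_sq_le_sq (by linarith [sq_nonneg x]) hpos⟩

/-- The a priori estimate. -/
theorem IsSolution.norm_le (hb : ∀ i, IsEigenpair q (l i) (b i)) (hM0 : 0 ≤ M)
    (hM : ∀ i, 1 ≤ l i + M) (hM' : ∀ i, |l i| ≤ l i + M) {T : ℝ} (hT : 0 < T) {a β : LInf}
    (ha : 0 ≤ a) (hβ : 0 ≤ β) {u₀ u₀'' u₁ : L2} (h₀ : HasWeakSecondDeriv u₀ u₀'')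
    (h₀' : VanishesAtEndpoints u₀) {u : ℝ → L2} (h : IsSolution T q a β u₀ u₁ u)
    {t : ℝ} (ht : t ∈ Icc 0 T) {w : L2} (hw : IsFractionalPower q (1 / 2) (u t) w) :
    max (max ‖u t‖ ‖w‖) ‖timeDeriv T u t‖ ≤ Real.exp (M * T) * (1 + M) *
      ((1 + ‖q‖) * (1 + ‖a‖) * (1 + ‖β‖) * (‖u₀‖ + ‖u₀''‖ + ‖u₁‖)) := by
  obtain ⟨p, hp, hE⟩ := h.exists_energy_le hb hM0 hM hT ha hβ
  have h0 : (0 : ℝ) ∈ Icc 0 T := left_mem_Icc.2 hT.le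
  have hu_le : ‖u t‖ ≤ ‖p t‖ := by
    have := norm_le_of_norm_inner_le b (x := u t) (y := p t) zero_le_one fun i => by
      rw [hp t ht, norm_mul, one_mul, Complex.norm_real, Real.norm_of_nonneg (Real.sqrt_nonneg _)]
      exact le_mul_of_one_le_left (norm_nonneg _) (Real.one_le_sqrt.2 (hM i))
    rwa [one_mul] at this
  -- Only the modulus `|l|^{1/2}` matters, so negative eigenvalues with imaginary square root are
  -- harmless.
  have hw_le : ‖w‖ ≤ ‖p t‖ := by
    have := norm_le_of_norm_inner_le b (x := w) (y := p t) zero_le_one fun i => by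
      rw [hp t ht, hw _ _ (hb i), norm_mul, one_mul, norm_mul, Complex.norm_real,
        Real.norm_of_nonneg (Real.sqrt_nonneg _)]
      gcongr
      exact norm_cpow_half_le hM' i
    rwa [one_mul] at this
  -- `‖p(0)‖² = ⟨u₀, (𝓛 + M) u₀⟩`; this is where `u₀''` enters.
  have hp0 : ‖p 0‖ ^ 2 = (inner ℂ u₀ (-u₀'' + q • u₀ + (M : ℂ) • u₀)).re := by
    rw [← inner_self_eq_norm_sq (𝕜 := ℂ), RCLike.re_eq_complex_re]
    congr 1
    refine inner_eq_inner_of_basis b fun i => ?_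
    rw [inner_add_right, inner_basis_isSturmLiouville hb ⟨h₀', u₀'', h₀, rfl⟩, inner_smul_right,
      ← add_mul, ← sq_sqrt_shift hM, hp 0 h0, h.initial, map_mul, Complex.conj_ofReal]
    ring
  have hp0_le : ‖p 0‖ ^ 2 ≤ ‖u₀‖ * (‖u₀''‖ + ‖q‖ * ‖u₀‖ + M * ‖u₀‖) := by
    rw [hp0]
    refine (Complex.re_le_norm _).trans ((norm_inner_le_norm _ _).trans ?_)
    gcongr
    refine (norm_add_le _ _).trans (add_le_add ((norm_add_le _ _).trans (add_le_add ?_ ?_)) ?_)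
    · rw [norm_neg]
    · exact Lp.norm_smul_le q u₀
    · rw [norm_smul, Complex.norm_real, Real.norm_of_nonneg hM0]
  have ha_le : (inner ℂ u₀ (mulL a u₀)).re ≤ ‖a‖ * ‖u₀‖ ^ 2 :=
    (le_abs_self _).trans (abs_re_inner_mulL_le a u₀)
  obtain ⟨h1, h2⟩ := energy_arith (norm_nonneg q) (norm_nonneg a) (norm_nonneg β) hM0 hT.le
    (norm_nonneg u₀) (norm_nonneg u₀'') (norm_nonneg u₁) hp0_le ha_le (hE t ht)
  exact max_le (max_le (hu_le.trans h1) (hw_le.trans h1)) h2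

/-- The oscillator is solved for `p`, and then `u = (𝓛 + M)^{-1/2} p`; this operator `D` is bounded,
hence so is the force `N`. The operator `P` is `𝓛^{1/2} (𝓛 + M)^{-1/2}`, which gives continuity of
`𝓛^{1/2} u`. -/
theorem exists_isSolution (hb : ∀ i, IsEigenpair q (l i) (b i))
    (hM : ∀ i, 1 ≤ l i + M) (hM' : ∀ i, |l i| ≤ l i + M) {T : ℝ} (hT : 0 < T) (a β : LInf)
    {u₀ u₀'' : L2} (u₁ : L2) (h₀ : HasWeakSecondDeriv u₀ u₀'')
    (h₀' : VanishesAtEndpoints u₀) : ∃ u, IsSolution T q a β u₀ u₁ u := by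
  have hs (i : ι) : 1 ≤ √(l i + M) := Real.one_le_sqrt.2 (hM i)
  have hs0 (i : ι) : ((√(l i + M) : ℝ) : ℂ) ≠ 0 := by
    exact_mod_cast (zero_lt_one.trans_le (hs i)).ne'
  obtain ⟨D, hD, -⟩ := exists_diagonal b (C := 1) zero_le_one
    (m := fun i => ((√(l i + M) : ℝ) : ℂ)⁻¹) (fun i => by
      rw [norm_inv, Complex.norm_real, Real.norm_of_nonneg (Real.sqrt_nonneg _)]
      exact inv_le_one_of_one_le₀ (hs i))
  obtain ⟨P, hP, -⟩ := exists_diagonal b (C := 1) zero_le_one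
    (m := fun i => (l i : ℂ) ^ ((1 / 2 : ℝ) : ℂ) * ((√(l i + M) : ℝ) : ℂ)⁻¹) (fun i => by
      rw [norm_mul, norm_inv, Complex.norm_real, Real.norm_of_nonneg (Real.sqrt_nonneg _),
        ← div_eq_mul_inv]
      exact div_le_one_of_le₀ (norm_cpow_half_le hM' i) (Real.sqrt_nonneg _))
  -- `k₀ = (𝓛 + M) u₀`, so that `D k₀ = (𝓛 + M)^{1/2} u₀` is the initial value of `p`.
  let k₀ : L2 := -u₀'' + q • u₀ + (M : ℂ) • u₀
  have hk₀ (i : ι) : inner ℂ (b i) k₀ =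
      (√(l i + M) : ℝ) * ((√(l i + M) : ℝ) * inner ℂ (b i) u₀) := by
    rw [inner_add_right, inner_basis_isSturmLiouville hb ⟨h₀', u₀'', h₀, rfl⟩, inner_smul_right,
      ← add_mul, ← sq_sqrt_shift hM, mul_assoc]
  let N : L2 × L2 →L[ℂ] L2 := (((M : ℂ) • ContinuousLinearMap.id ℂ L2 - mulL a) ∘L D) ∘L
    ContinuousLinearMap.fst ℂ L2 L2 - mulL β ∘L ContinuousLinearMap.snd ℂ L2 L2
  obtain ⟨p, r, hosc, hp0, hr0⟩ :=
    SturmLiouville.exists_isOscillator b (fun i => √(l i + M)) hT.le N (D k₀) u₁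
  have hN (t : ℝ) : N (p t, r t) = (M : ℂ) • D (p t) - mulL a (D (p t)) - mulL β (r t) := rfl
  have hu : ContinuousOn (fun t => D (p t)) (Icc 0 T) := D.continuous.comp_continuousOn hosc.cont_fst
  have hu' : ∀ t ∈ Icc 0 T, HasDerivWithinAt (fun t => D (p t)) (r t) (Icc 0 T) t := by
    refine hasDerivWithinAt_of_inner_basis b hT.le hosc.cont_snd fun i t ht => ?_
    simp only [hD]
    refine ((hosc.deriv_fst i t ht).const_mul _).congr_deriv ?_
    rw [inv_mul_cancel_left₀ (hs0 i)]
  have hdt (t : ℝ) (ht : t ∈ Icc 0 T) : timeDeriv T (fun t => D (p t)) t = r t :=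
    (hu' t ht).derivWithin (uniqueDiffOn_Icc hT t ht)
  have h0 : (0 : ℝ) ∈ Icc 0 T := left_mem_Icc.2 hT.le
  refine ⟨fun t => D (p t), ⟨hu, fun t => P (p t), fun t ht => ?_,
    P.continuous.comp_continuousOn hosc.cont_fst⟩, ?_, fun ψ Lψ hψ t ht => ?_, ?_, ?_,
    fun t ht => ?_⟩
  · refine isFractionalPower_of_basis hb fun i => ?_
    rw [hP, hD, mul_assoc]
  · rw [contDiffOn_one_iff_derivWithin (uniqueDiffOn_Icc hT)]
    exact ⟨fun t ht => (hu' t ht).differentiableWithinAt, hosc.cont_snd.congr hdt⟩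
  -- `r` itself need not be differentiable in `L²`, but `(𝓛 + M)⁻¹ r = D (D r)` is; the missing
  -- factor `𝓛 + M` is moved onto `ψ`.
  · have h1 : ∀ t ∈ Icc 0 T, HasDerivWithinAt (fun t => D (D (r t)))
        (-D (p t) + D (D (N (p t, r t)))) (Icc 0 T) t := by
      refine hasDerivWithinAt_of_inner_basis b hT.le (hu.neg.add (D.continuous.comp_continuousOn
        (D.continuous.comp_continuousOn hosc.cont_force))) fun i t ht => ?_
      simp only [hD, inner_add_right, inner_neg_right]
      refine (((hosc.deriv_snd i t ht).const_mul _).const_mul _).congr_deriv ?_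
      have := hs0 i
      field_simp
    have hDD (x : L2) : inner ℂ ψ x = inner ℂ (Lψ + (M : ℂ) • ψ) (D (D x)) := by
      refine inner_eq_inner_of_basis b fun i => ?_
      rw [hD, hD, inner_add_right, inner_basis_isSturmLiouville hb hψ, inner_smul_right,
        ← add_mul, ← sq_sqrt_shift hM, map_mul, map_mul, Complex.conj_ofReal]
      have := hs0 i
      field_simp
    have h2 := (h1 t ht).const_inner (Lψ + (M : ℂ) • ψ)
    have h3 : HasDerivWithinAt (fun τ => inner ℂ ψ (timeDeriv T (fun t => D (p t)) τ)) _
        (Icc 0 T) t := h2.congr (fun τ hτ => by rw [hdt τ hτ, hDD]) (by rw [hdt t ht, hDD])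
    refine h3.congr_deriv ?_
    rw [inner_add_right, ← hDD, hdt t ht, hN, ← mulL_apply, ← mulL_apply]
    simp only [inner_sub_right, inner_add_left, inner_smul_left, inner_smul_right, inner_neg_right,
      Complex.conj_ofReal]
    ring
  · refine ext_inner_basis b fun i => ?_
    rw [hp0, hD, hD, hk₀, inv_mul_cancel_left₀ (hs0 i), inv_mul_cancel_left₀ (hs0 i)]
  · rw [hdt 0 h0, hr0]
  · refine vanishesAtEndpoints_of_summable hb ((hasSum_norm_inner_sq b (p t)).summable.of_nonneg_of_le
      (fun i => by positivity) fun i => ?_)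
    have h1 : inner ℂ (b i) (p t) = (√(l i + M) : ℝ) * inner ℂ (b i) (D (p t)) := by
      rw [hD, mul_inv_cancel_left₀ (hs0 i)]
    rw [h1, norm_mul, mul_pow, Complex.norm_real, Real.norm_of_nonneg (Real.sqrt_nonneg _),
      Real.sq_sqrt (zero_le_one.trans (hM i))]
    gcongr
    exact hM' i

end Basis

/-- Reason for the shift `M = 2|m| + 1`: `𝓛 + M ≥ 1` needs `M ≥ 1 - m`, and `|l| ≤ l + M` for
negative `l` needs `M ≥ -2l`, which is at most `2|m|`. -/
lemma one_le_add_shift {m l : ℝ} (h : m ≤ l) : 1 ≤ l + (2 * |m| + 1) := by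
  linarith [neg_abs_le m, abs_nonneg m]

lemma abs_le_add_shift {m l : ℝ} (h : m ≤ l) : |l| ≤ l + (2 * |m| + 1) :=
  abs_le.2 ⟨by linarith [neg_abs_le m], by linarith [abs_nonneg m]⟩

end SturmLiouville

theorem mainTheorem3 (T : ℝ) (hT : 0 < T) :
    (∀ (q a b : SturmLiouville.LInf) (u₀ u₀'' u₁ : SturmLiouville.L2),
      0 ≤ a → 0 ≤ b →
      SturmLiouville.HasWeakSecondDeriv u₀ u₀'' → SturmLiouville.VanishesAtEndpoints u₀ →
      ∃ u : ℝ → SturmLiouville.L2, SturmLiouville.IsSolution T q a b u₀ u₁ u ∧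
        ∀ v : ℝ → SturmLiouville.L2, SturmLiouville.IsSolution T q a b u₀ u₁ v →
          Set.EqOn v u (Set.Icc 0 T)) ∧
    (∀ m : ℝ, ∃ C : ℝ, 0 < C ∧
      ∀ (q a b : SturmLiouville.LInf) (u₀ u₀'' u₁ : SturmLiouville.L2),
        0 ≤ a → 0 ≤ b →
        SturmLiouville.HasWeakSecondDeriv u₀ u₀'' → SturmLiouville.VanishesAtEndpoints u₀ →
        (∀ (l : ℝ) (φ : SturmLiouville.L2), SturmLiouville.IsEigenpair q l φ → m ≤ l) →
        ∀ u : ℝ → SturmLiouville.L2, SturmLiouville.IsSolution T q a b u₀ u₁ u →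
          ∀ t ∈ Set.Icc 0 T, ∀ w : SturmLiouville.L2,
            SturmLiouville.IsFractionalPower q (1 / 2) (u t) w →
            ‖u t‖ ≤ C * ((1 + ‖q‖) * (1 + ‖a‖) * (1 + ‖b‖) * (‖u₀‖ + ‖u₀''‖ + ‖u₁‖)) ∧
            ‖w‖ ≤ C * ((1 + ‖q‖) * (1 + ‖a‖) * (1 + ‖b‖) * (‖u₀‖ + ‖u₀''‖ + ‖u₁‖)) ∧
            ‖SturmLiouville.timeDeriv T u t‖ ≤
              C * ((1 + ‖q‖) * (1 + ‖a‖) * (1 + ‖b‖) * (‖u₀‖ + ‖u₀''‖ + ‖u₁‖))) := by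
  refine ⟨fun q a β u₀ u₀'' u₁ ha hβ h₀ h₀' => ?_, fun m => ⟨Real.exp ((2 * |m| + 1) * T) *
    (1 + (2 * |m| + 1)), by positivity, ?_⟩⟩
  · obtain ⟨ι, e, l, he⟩ := SturmLiouville.exists_hilbertBasis_isEigenpair q
    -- Existence needs no uniform constant, so the spectral bound `-‖q‖`, always available, fixes
    -- the shift.
    have hl (i : ι) : -‖q‖ ≤ l i := (he i).neg_norm_le
    have hM1 (i : ι) := SturmLiouville.one_le_add_shift (hl i)
    have hM2 (i : ι) := SturmLiouville.abs_le_add_shift (hl i)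
    obtain ⟨u, hu⟩ := SturmLiouville.exists_isSolution he hM1 hM2 hT a β u₁ h₀ h₀'
    refine ⟨u, hu, fun v hv t ht => ?_⟩
    have hd := hv.sub hT hu
    obtain ⟨-, w, hw, -⟩ := hd.continuous_sobolev
    have h0 : SturmLiouville.HasWeakSecondDeriv 0 0 :=
      SturmLiouville.hasWeakSecondDeriv_iff.2 fun φ hφ => by simp
    have h0' : SturmLiouville.VanishesAtEndpoints 0 :=
      (SturmLiouville.IsSturmLiouville.zero q).1
    -- With zero data the right side of the estimate is zero.
    have key := hd.norm_le he (by positivity) hM1 hM2 hT ha hβ h0 h0' ht (hw t ht)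
    simp only [norm_zero, add_zero, mul_zero] at key
    exact sub_eq_zero.1 (norm_le_zero_iff.1 (((le_max_left _ _).trans (le_max_left _ _)).trans key))
  · intro q a β u₀ u₀'' u₁ ha hβ h₀ h₀' hm u hu t ht w hw
    obtain ⟨ι, e, l, he⟩ := SturmLiouville.exists_hilbertBasis_isEigenpair q
    have hl (i : ι) : m ≤ l i := hm _ _ (he i)
    have key := hu.norm_le he (by positivity)
      (fun i => SturmLiouville.one_le_add_shift (hl i))
      (fun i => SturmLiouville.abs_le_add_shift (hl i)) hT ha hβ h₀ h₀' ht hw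
    exact ⟨((le_max_left _ _).trans (le_max_left _ _)).trans key,
      ((le_max_right _ _).trans (le_max_left _ _)).trans key, (le_max_right _ _).trans key⟩
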